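/- Let $k$ be a field and $H$ a Hopf algebra over $k$ with bijective antipode $\mathcal S$. Consider the braided category of (not necessarily finite-dimensional) left Yetter--Drinfeld modules over $H$, i.e. left $H$-modules and left $H$-comodules $M$ with $\delta(hm)=h_{(1)}m_{(-1)}\mathcal S(h_{(3)})\otimes h_{(2)}m_{(0)}$, with braiding $c(m\otimes n)=m_{(-1)}n\otimes m_{(0)}$. A TOBA is a graded Hopf algebra $R=\bigoplus_{n\ge 0}R(n)$ in this category (the $R(n)$ are Yetter--Drinfeld submodules, $R(i)R(j)\subseteq R(i+j)$, $\Delta(R(n))\subseteq\bigoplus_{i+j=n}R(i)\otimes R(j)$) such that $R(0)\simeq k$, $\left(\bigoplus_{i\ge 1}R(i)\right)^2=\bigoplus_{i\ge 2}R(i)$, and the space $\{x\in R : \Delta(x)=x\otimes 1+1\otimes x\}$ of primitive elements equals $R(1)$. For a Yetter--Drinfeld module $V$, let $A(V)$ be the tensor algebra of $V$ with the diagonal action and coaction and with the comultiplication which is the algebra map to the braided tensor product $A(V)\otimes A(V)$ determined by $\Delta(v)=v\otimes 1+1\otimes v$ for $v\in V$. For $w\in\mathbb S_n$ let $s(w)=c_{i_1}\cdots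 c_{i_j}\in\operatorname{End}(V^{\otimes n})$, where $w=\tau_{i_1}\cdots\tau_{i_j}$ is a word of minimal length in the elementary transpositions $\tau_i=(i,i+1)$ and $c_i$ is the braiding $c_{V,V}$ applied to the tensor factors $i,i+1$. Let $\mathfrak S^n=\sum_{w\in\mathbb S_n}s(w)$, $\mathfrak S=\bigoplus_n\mathfrak S^n$, and $\mathfrak B(V)=A(V)/\ker\mathfrak S$ with the structure induced from $A(V)$. Let $R$ be a TOBA, $V=R(1)$, and let $p:A(V)\to R$ be the algebra map induced by the inclusion $V\hookrightarrow R$. Then: 1. $p$ is surjective and $\ker p=\ker\mathfrak S$; 2. $p$ induces an isomorphism $\mathfrak B(V)\simeq R$ of graded Hopf algebras in the category of Yetter--Drinfeld modules; 3. a TOBA is determined up to isomorphism by its space of primitive elements: if $R'$ is another TOBA over $H$ and $f:R(1)\to R'(1)$ is an isomorphism of Yetter--Drinfeld modules, then there is an isomorphism $R\to R'$ of graded Hopf algebras in the category of Yetter--Drinfeld modules which extends $f$. -/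

import Mathlib

open scoped TensorProduct DirectSum

noncomputable section

/-! ### Yetter–Drinfeld modules -/

section YD

variable {k H M N : Type*} [Field k] [Ring H] [HopfAlgebra k H]
  [AddCommGroup M] [Module k M] [AddCommGroup N] [Module k N]

/-- The structure maps of a left `H`-module and left `H`-comodule on `M` (without axioms; see
`YDData.IsYetterDrinfeld`): `act h m = h • m` and `coact m = m₍₋₁₎ ⊗ m₍₀₎`. -/
structure YDData (k H M : Type*) [Field k] [Ring H] [HopfAlgebra k H]
    [AddCommGroup M] [Module k M] where
  act : H →ₗ[k] Module.End k M
  coact : M →ₗ[k] H ⊗[k] M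

namespace YDData

/-- `a ⊗ c ↦ (x ↦ a * x * S c)` on a Hopf algebra `H` with antipode `S`. -/
def mulAntipode (k H : Type*) [Field k] [Ring H] [HopfAlgebra k H] :
    H ⊗[k] H →ₗ[k] Module.End k H :=
  TensorProduct.lift (LinearMap.mk₂ k
    (fun a c => LinearMap.mulLeft k a ∘ₗ LinearMap.mulRight k (HopfAlgebra.antipode k c))
    (by intros; ext; simp [add_mul]) (by intros; ext; simp)
    (by intros; ext; simp [mul_add]) (by intros; ext; simp))

/-- The map `h ↦ (x ⊗ m ↦ h₍₁₎ x S(h₍₃₎) ⊗ h₍₂₎ • m)`. -/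
def twistedAct (D : YDData k H M) : H →ₗ[k] Module.End k (H ⊗[k] M) :=
  TensorProduct.homTensorHomMap (.id k) H M H M
    ∘ₗ TensorProduct.map (mulAntipode k H) D.act
    ∘ₗ (TensorProduct.assoc k H H H).symm.toLinearMap
    ∘ₗ (TensorProduct.comm k H H).toLinearMap.lTensor H
    ∘ₗ (Coalgebra.comul (R := k) (A := H)).lTensor H
    ∘ₗ Coalgebra.comul

/-- `M` is a left Yetter–Drinfeld module over `H`: a left module, a left comodule, and
`δ(h • m) = h₍₁₎ m₍₋₁₎ S(h₍₃₎) ⊗ h₍₂₎ • m₍₀₎`. -/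
structure IsYetterDrinfeld (D : YDData k H M) : Prop where
  act_one : D.act 1 = 1
  act_mul : ∀ g h : H, D.act (g * h) = D.act g * D.act h
  coassoc : (TensorProduct.assoc k H H M).toLinearMap ∘ₗ
    (Coalgebra.comul (R := k) (A := H)).rTensor M ∘ₗ D.coact = D.coact.lTensor H ∘ₗ D.coact
  counit_coact : (TensorProduct.lid k M).toLinearMap ∘ₗ
    (Coalgebra.counit (R := k) (A := H)).rTensor M ∘ₗ D.coact = LinearMap.id
  coact_act : ∀ (h : H) (m : M), D.coact (D.act h m) = D.twistedAct h (D.coact m)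

/-- Morphisms of Yetter–Drinfeld modules: linear maps that are `H`-linear and `H`-colinear. -/
structure IsHom (D : YDData k H M) (D' : YDData k H N) (f : M →ₗ[k] N) : Prop where
  map_act : ∀ (h : H) (m : M), f (D.act h m) = D'.act h (f m)
  map_coact : ∀ m : M, D'.coact (f m) = f.lTensor H (D.coact m)

/-- The unit object: `k` with the trivial action `h • a = ε(h) a` and coaction `a ↦ 1 ⊗ a`. -/
def unit (k H : Type*) [Field k] [Ring H] [HopfAlgebra k H] : YDData k H k where
  act := (LinearMap.lsmul k k) ∘ₗ Coalgebra.counit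
  coact := TensorProduct.mk k H k 1

/-- The tensor product: diagonal action `h • (m ⊗ n) = h₍₁₎ • m ⊗ h₍₂₎ • n` and coaction
`m ⊗ n ↦ m₍₋₁₎ n₍₋₁₎ ⊗ (m₍₀₎ ⊗ n₍₀₎)`. -/
def tensor (D : YDData k H M) (D' : YDData k H N) : YDData k H (M ⊗[k] N) where
  act := TensorProduct.homTensorHomMap (.id k) M N M N ∘ₗ TensorProduct.map D.act D'.act
    ∘ₗ Coalgebra.comul
  coact := (LinearMap.mul' k H).rTensor (M ⊗[k] N)
    ∘ₗ (TensorProduct.tensorTensorTensorComm k H M H N).toLinearMap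
    ∘ₗ TensorProduct.map D.coact D'.coact

/-- The braiding `c_{M,N} : M ⊗ N → N ⊗ M`, `m ⊗ n ↦ m₍₋₁₎ • n ⊗ m₍₀₎`. -/
def braiding (D : YDData k H M) (D' : YDData k H N) : M ⊗[k] N →ₗ[k] N ⊗[k] M :=
  (TensorProduct.lift D'.act).rTensor M
    ∘ₗ (TensorProduct.assoc k H N M).symm.toLinearMap
    ∘ₗ (TensorProduct.comm k M N).toLinearMap.lTensor H
    ∘ₗ (TensorProduct.assoc k H M N).toLinearMap
    ∘ₗ D.coact.rTensor N

/-- A subspace stable under the action and the coaction (`δ(W) ⊆ H ⊗ W`). -/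
structure IsSub (D : YDData k H M) (W : Submodule k M) : Prop where
  act_mem : ∀ (h : H), ∀ m ∈ W, D.act h m ∈ W
  coact_mem : ∀ m ∈ W, D.coact m ∈ LinearMap.range (W.subtype.lTensor H)

/-- The Yetter–Drinfeld structure induced on a stable subspace. -/
def restrict (D : YDData k H M) (W : Submodule k M) (hW : D.IsSub W) : YDData k H W where
  act := LinearMap.mk₂ k (fun h (w : W) => (⟨D.act h w, hW.act_mem h w w.2⟩ : W))
    (by intros; ext; simp) (by intros; ext; simp) (by intros; ext; simp) (by intros; ext; simp)
  coact := (LinearEquiv.ofInjective (W.subtype.lTensor H)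
      (Module.Flat.lTensor_preserves_injective_linearMap _ W.injective_subtype)).symm.toLinearMap
    ∘ₗ LinearMap.codRestrict _ (D.coact ∘ₗ W.subtype) (fun w => hW.coact_mem w w.2)

end YDData

end YD

/-! ### Braided Hopf algebras and TOBAs -/

section Hopf

variable {k H R : Type*} [Field k] [Ring H] [HopfAlgebra k H] [Ring R] [Algebra k R]

/-- The product `(m ⊗ m)(id ⊗ c ⊗ id)` of the braided tensor product algebra `R ⊗ R`. -/
def YDData.braidedMul (D : YDData k H R) :
    (R ⊗[k] R) ⊗[k] (R ⊗[k] R) →ₗ[k] R ⊗[k] R :=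
  TensorProduct.map (LinearMap.mul' k R) (LinearMap.mul' k R)
    ∘ₗ (TensorProduct.assoc k R R (R ⊗[k] R)).symm.toLinearMap
    ∘ₗ ((TensorProduct.assoc k R R R).toLinearMap
        ∘ₗ (D.braiding D).rTensor R
        ∘ₗ (TensorProduct.assoc k R R R).symm.toLinearMap).lTensor R
    ∘ₗ (TensorProduct.assoc k R R (R ⊗[k] R)).toLinearMap

variable [Coalgebra k R]

/-- `R` is a Hopf algebra in the braided category of left Yetter–Drinfeld modules over `H`. -/
structure IsBraidedHopfAlgebra (D : YDData k H R) : Prop where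
  yetterDrinfeld : D.IsYetterDrinfeld
  mul_hom : (D.tensor D).IsHom D (LinearMap.mul' k R)
  unit_hom : (YDData.unit k H).IsHom D (Algebra.linearMap k R)
  comul_hom : D.IsHom (D.tensor D) Coalgebra.comul
  counit_hom : D.IsHom (YDData.unit k H) Coalgebra.counit
  counit_one : Coalgebra.counit (R := k) (1 : R) = 1
  counit_mul : ∀ x y : R, Coalgebra.counit (R := k) (x * y) =
    Coalgebra.counit (R := k) x * Coalgebra.counit (R := k) y
  comul_one : Coalgebra.comul (R := k) (1 : R) = 1 ⊗ₜ[k] 1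
  comul_mul : ∀ x y : R, Coalgebra.comul (R := k) (x * y) =
    D.braidedMul (Coalgebra.comul (R := k) x ⊗ₜ[k] Coalgebra.comul (R := k) y)
  exists_antipode : ∃ S : R →ₗ[k] R, D.IsHom D S ∧
    LinearMap.mul' k R ∘ₗ S.rTensor R ∘ₗ Coalgebra.comul =
      Algebra.linearMap k R ∘ₗ Coalgebra.counit ∧
    LinearMap.mul' k R ∘ₗ S.lTensor R ∘ₗ Coalgebra.comul =
      Algebra.linearMap k R ∘ₗ Coalgebra.counit

/-- A grading `R = ⨁ₙ R(n)` by Yetter–Drinfeld submodules making `R` a graded Hopf algebra. -/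
structure IsGradedBraidedHopfAlgebra (D : YDData k H R) (𝒜 : ℕ → Submodule k R) : Prop
    extends IsBraidedHopfAlgebra D where
  isInternal : DirectSum.IsInternal 𝒜
  isSub : ∀ n, D.IsSub (𝒜 n)
  mul_mem : ∀ i j, ∀ x ∈ 𝒜 i, ∀ y ∈ 𝒜 j, x * y ∈ 𝒜 (i + j)
  comul_mem : ∀ n, ∀ x ∈ 𝒜 n, Coalgebra.comul (R := k) x ∈
    ⨆ (i : ℕ) (j : ℕ) (_ : i + j = n),
      LinearMap.range (TensorProduct.map (𝒜 i).subtype (𝒜 j).subtype)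

/-- The space of primitive elements `{x | Δ(x) = 1 ⊗ x + x ⊗ 1}`. -/
def primitives (k R : Type*) [Field k] [Ring R] [Algebra k R] [Coalgebra k R] :
    Submodule k R :=
  LinearMap.eqLocus (Coalgebra.comul (R := k) (A := R))
    (TensorProduct.mk k R R 1 + (TensorProduct.mk k R R).flip 1)

/-- Braided Hopf algebras of type one. -/
structure IsTOBA (D : YDData k H R) (𝒜 : ℕ → Submodule k R) : Prop
    extends IsGradedBraidedHopfAlgebra D 𝒜 where
  zero_equiv : Nonempty (𝒜 0 ≃ₗ[k] k)
  sq_augmentation : (⨆ i ≥ 1, 𝒜 i) * (⨆ i ≥ 1, 𝒜 i) = ⨆ i ≥ 2, 𝒜 i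
  primitives_eq : primitives k R = 𝒜 1

/-- The Yetter–Drinfeld module `V = R(1)`. -/
def IsTOBA.degreeOne {D : YDData k H R} {𝒜 : ℕ → Submodule k R} (h : IsTOBA D 𝒜) :
    YDData k H (𝒜 1) :=
  D.restrict (𝒜 1) (h.isSub 1)

end Hopf

/-! ### Reduced words in the symmetric group -/

namespace SymmGroup

/-- Indices of the elementary transpositions of `Fin n`. -/
abbrev Idx (n : ℕ) := {i : ℕ // i + 1 < n}

/-- The left position `i` of the elementary transposition `(i, i+1)`. -/
def Idx.left {n : ℕ} (i : Idx n) : Fin n := ⟨i.1, Nat.lt_of_succ_lt i.2⟩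

/-- The right position `i + 1` of the elementary transposition `(i, i+1)`. -/
def Idx.right {n : ℕ} (i : Idx n) : Fin n := ⟨i.1 + 1, i.2⟩

/-- The permutation `τ_{i₁} ⋯ τ_{iⱼ}` represented by a word. -/
def wordPerm {n : ℕ} (l : List (Idx n)) : Equiv.Perm (Fin n) :=
  (l.map fun i => Equiv.swap i.left i.right).prod

/-- `l` is a word of minimal length representing the permutation `w`. -/
def IsReducedWord {n : ℕ} (w : Equiv.Perm (Fin n)) (l : List (Idx n)) : Prop :=
  wordPerm l = w ∧ ∀ l', wordPerm l' = w → l.length ≤ l'.length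

theorem exists_word {n : ℕ} (w : Equiv.Perm (Fin n)) : ∃ l, wordPerm l = w := by
  cases n with
  | zero => exact ⟨[], Subsingleton.elim _ _⟩
  | succ n =>
    have hw : w ∈ Submonoid.closure
        (Set.range fun i : Fin n => Equiv.swap i.castSucc i.succ) := by
      rw [Equiv.Perm.mclosure_swap_castSucc_succ]; trivial
    induction hw using Submonoid.closure_induction with
    | mem x hx =>
      obtain ⟨i, rfl⟩ := hx
      exact ⟨[⟨i.1, by omega⟩], by simp [wordPerm]; rfl⟩
    | one => exact ⟨[], rfl⟩
    | mul x y _ _ hx hy =>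
      obtain ⟨l, rfl⟩ := hx
      obtain ⟨l', rfl⟩ := hy
      exact ⟨l ++ l', by simp [wordPerm]⟩

theorem exists_reducedWord {n : ℕ} (w : Equiv.Perm (Fin n)) : ∃ l, IsReducedWord w l := by
  classical
  have h : ∃ m, ∃ l, wordPerm l = w ∧ l.length = m :=
    let ⟨l, hl⟩ := exists_word w; ⟨_, l, hl, rfl⟩
  obtain ⟨l, hl, hm⟩ := Nat.find_spec h
  exact ⟨l, hl, fun l' hl' => hm ▸ Nat.find_min' h ⟨l', hl', rfl⟩⟩

/-- A word of minimal length representing `w`. -/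
def reducedWord {n : ℕ} (w : Equiv.Perm (Fin n)) : List (Idx n) :=
  (exists_reducedWord w).choose

end SymmGroup

/-! ### The quantum symmetrizer -/

section Symmetrizer

variable {k H V : Type*} [Field k] [Ring H] [HopfAlgebra k H] [AddCommGroup V] [Module k V]

open Function in
/-- `a ⊗ b ↦ v₁ ⊗ ⋯ ⊗ a ⊗ ⋯ ⊗ b ⊗ ⋯ ⊗ vₙ`, with `a` at position `i` and `b` at position `j`. -/
def insertPair {n : ℕ} (i j : Fin n) (hij : i ≠ j) (v : Fin n → V) :
    V ⊗[k] V →ₗ[k] ⨂[k]^n V :=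
  TensorProduct.lift (LinearMap.mk₂ k
    (fun a b => PiTensorProduct.tprod k (update (update v i a) j b))
    (by intro a a' b
        simp only [update_comm hij]
        exact (PiTensorProduct.tprod k).map_update_add _ _ _ _)
    (by intro c a b
        simp only [update_comm hij]
        exact (PiTensorProduct.tprod k).map_update_smul _ _ _ _)
    (by intros; exact (PiTensorProduct.tprod k).map_update_add _ _ _ _)
    (by intros; exact (PiTensorProduct.tprod k).map_update_smul _ _ _ _))

open Function in
theorem insertPair_tmul {n : ℕ} (i j : Fin n) (hij : i ≠ j) (v : Fin n → V) (a b : V) :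
    insertPair (k := k) i j hij v (a ⊗ₜ b) =
      PiTensorProduct.tprod k (update (update v i a) j b) := rfl

open Function in
theorem insertPair_update_left {n : ℕ} (i j : Fin n) (hij : i ≠ j) (v : Fin n → V) (x : V) :
    insertPair (k := k) i j hij (update v i x) = insertPair i j hij v := by
  ext a b
  simp [insertPair_tmul]

open Function in
theorem insertPair_update_right {n : ℕ} (i j : Fin n) (hij : i ≠ j) (v : Fin n → V) (x : V) :
    insertPair (k := k) i j hij (update v j x) = insertPair i j hij v := by
  ext a b
  simp [insertPair_tmul, update_comm hij]

open Function in
theorem insertPair_update_add {n : ℕ} (i j : Fin n) (hij : i ≠ j) (v : Fin n → V) (m : Fin n)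
    (hi : m ≠ i) (hj : m ≠ j) (x y : V) :
    insertPair (k := k) i j hij (update v m (x + y)) =
      insertPair i j hij (update v m x) + insertPair i j hij (update v m y) := by
  ext a b
  have h : ∀ z : V, update (update (update v m z) i a) j b
      = update (update (update v i a) j b) m z := by
    intro z; rw [update_comm hi, update_comm hj]
  simp [insertPair_tmul, h]

open Function in
theorem insertPair_update_smul {n : ℕ} (i j : Fin n) (hij : i ≠ j) (v : Fin n → V) (m : Fin n)
    (hi : m ≠ i) (hj : m ≠ j) (c : k) (x : V) :
    insertPair (k := k) i j hij (update v m (c • x)) =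
      c • insertPair (k := k) i j hij (update v m x) := by
  ext a b
  have h : ∀ z : V, update (update (update v m z) i a) j b
      = update (update (update v i a) j b) m z := by
    intro z; rw [update_comm hi, update_comm hj]
  simp [insertPair_tmul, h]

/-- The endomorphism of `V^{⊗n}` applying `c : V ⊗ V → V ⊗ V` at the positions `i ≠ j`. -/
def applyAt (c : V ⊗[k] V →ₗ[k] V ⊗[k] V) {n : ℕ} (i j : Fin n) (hij : i ≠ j) :
    Module.End k (⨂[k]^n V) :=
  PiTensorProduct.lift (MultilinearMap.mk' (fun v => insertPair i j hij v (c (v i ⊗ₜ v j)))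
    (by
      intro v m x y
      by_cases hi : m = i
      · subst hi
        simp [insertPair_update_left, Function.update_of_ne hij.symm, TensorProduct.add_tmul]
      · by_cases hj : m = j
        · subst hj
          simp [insertPair_update_right, Function.update_of_ne hij, TensorProduct.tmul_add]
        · simp [insertPair_update_add i j hij v m hi hj, Function.update_of_ne (Ne.symm hi),
            Function.update_of_ne (Ne.symm hj)])
    (by
      intro v m x y
      by_cases hi : m = i
      · subst hi
        simp [insertPair_update_left, Function.update_of_ne hij.symm,
          ← TensorProduct.smul_tmul']
      · by_cases hj : m = j
        · subst hj
          simp [insertPair_update_right, Function.update_of_ne hij]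
        · simp [insertPair_update_smul i j hij v m hi hj, Function.update_of_ne (Ne.symm hi),
            Function.update_of_ne (Ne.symm hj)]))

theorem applyAt_tprod (c : V ⊗[k] V →ₗ[k] V ⊗[k] V) {n : ℕ} (i j : Fin n) (hij : i ≠ j)
    (v : Fin n → V) :
    applyAt c i j hij (PiTensorProduct.tprod k v) = insertPair i j hij v (c (v i ⊗ₜ v j)) := by
  simp [applyAt]

namespace YDData

/-- The action on `V^{⊗n}` of the standard generator `σᵢ` of the braid group:
`id ⊗ ⋯ ⊗ c_{V,V} ⊗ ⋯ ⊗ id`, the braiding at the positions `i, i + 1`. -/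
def sigma (D : YDData k H V) {n : ℕ} (i : SymmGroup.Idx n) : Module.End k (⨂[k]^n V) :=
  applyAt (D.braiding D) i.left i.right (by simp [SymmGroup.Idx.left, SymmGroup.Idx.right])

/-- The action on `V^{⊗n}` of the lift `s(w) = σ_{i₁} ⋯ σ_{iⱼ}` of a permutation
`w = τ_{i₁} ⋯ τ_{iⱼ}` to the braid group, where the word is of minimal length. -/
def braidLift (D : YDData k H V) {n : ℕ} (w : Equiv.Perm (Fin n)) : Module.End k (⨂[k]^n V) :=
  ((SymmGroup.reducedWord w).map D.sigma).prod

/-- `𝔖ⁿ = ∑_{w ∈ Sₙ} s(w)`. -/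
def symmetrizer (D : YDData k H V) (n : ℕ) : Module.End k (⨂[k]^n V) :=
  ∑ w : Equiv.Perm (Fin n), D.braidLift w

/-- The quantum symmetrizer `𝔖 = ⨁ₙ 𝔖ⁿ` on the tensor algebra. -/
def quantumSymmetrizer (D : YDData k H V) : TensorAlgebra k V →ₗ[k] ⨁ n, ⨂[k]^n V :=
  DirectSum.lmap D.symmetrizer ∘ₗ TensorAlgebra.equivDirectSum.toLinearMap

end YDData

end Symmetrizer

/-! ### The braided bialgebra `A(V)` and `𝔅(V)` -/

section TensorAlg

variable {k H V : Type*} [Field k] [Ring H] [HopfAlgebra k H] [AddCommGroup V] [Module k V]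

namespace YDData

/-- `x ↦ (h ↦ h • x)` for the diagonal action of `H` on the tensor algebra: the algebra map into
the convolution algebra `Hom(H, T(V))` extending the action on `V`; that is,
`h • (x y) = (h₍₁₎ • x) (h₍₂₎ • y)` and `h • 1 = ε(h)`. -/
def tensorAlgebraOrbit (D : YDData k H V) :
    TensorAlgebra k V →ₐ[k] WithConv (H →ₗ[k] TensorAlgebra k V) :=
  TensorAlgebra.lift k ((WithConv.linearEquiv k (H →ₗ[k] TensorAlgebra k V)).symm.toLinearMap ∘ₗ
    LinearMap.llcomp k H V (TensorAlgebra k V) (TensorAlgebra.ι k) ∘ₗ D.act.flip)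

/-- The Yetter–Drinfeld structure on `T(V) = ⨁ₙ V^{⊗n}`: diagonal action and coaction
(the latter is the algebra map `T(V) → H ⊗ T(V)` extending the coaction of `V`). -/
def tensorAlgebra (D : YDData k H V) : YDData k H (TensorAlgebra k V) where
  act := ((WithConv.linearEquiv k (H →ₗ[k] TensorAlgebra k V)).toLinearMap ∘ₗ
    D.tensorAlgebraOrbit.toLinearMap).flip
  coact := (TensorAlgebra.lift k ((TensorAlgebra.ι k).lTensor H ∘ₗ D.coact)).toLinearMap

/-- The algebra map `A(V) → End(A(V) ⊗ A(V))` sending `v` to the left multiplication by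
`v ⊗ 1 + 1 ⊗ v` in the braided tensor product algebra. -/
def tensorAlgebraComulAux (D : YDData k H V) :
    TensorAlgebra k V →ₐ[k] Module.End k (TensorAlgebra k V ⊗[k] TensorAlgebra k V) :=
  TensorAlgebra.lift k (TensorProduct.curry D.tensorAlgebra.braidedMul ∘ₗ
    ((TensorProduct.mk k _ _).flip 1 + TensorProduct.mk k _ _ 1) ∘ₗ TensorAlgebra.ι k)

/-- The comultiplication of `A(V)`: the algebra map into the braided tensor product algebra
`A(V) ⊗ A(V)` with `Δ(v) = v ⊗ 1 + 1 ⊗ v` for `v ∈ V`. -/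
def tensorAlgebraComul (D : YDData k H V) :
    TensorAlgebra k V →ₗ[k] TensorAlgebra k V ⊗[k] TensorAlgebra k V :=
  LinearMap.applyₗ (1 ⊗ₜ 1) ∘ₗ D.tensorAlgebraComulAux.toLinearMap

/-- `𝔅(V) = A(V) / ker 𝔖`. -/
abbrev NicholsAlgebra (D : YDData k H V) : Type _ :=
  TensorAlgebra k V ⧸ LinearMap.ker D.quantumSymmetrizer

/-- The quotient map `A(V) → 𝔅(V)`. -/
abbrev toNichols (D : YDData k H V) : TensorAlgebra k V →ₗ[k] D.NicholsAlgebra :=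
  (LinearMap.ker D.quantumSymmetrizer).mkQ

/-- `φ : 𝔅(V) ≃ R` is an isomorphism of graded Hopf algebras in the Yetter–Drinfeld category,
where the structure maps of `𝔅(V)` are those induced by `A(V)`: they are written on
representatives `x ∈ A(V)`. -/
structure IsNicholsIso {R : Type*} [Ring R] [Algebra k R] [Coalgebra k R] (D : YDData k H V)
    (DR : YDData k H R) (𝒜 : ℕ → Submodule k R) (φ : D.NicholsAlgebra ≃ₗ[k] R) : Prop where
  map_one : φ (D.toNichols 1) = 1
  map_mul : ∀ x y, φ (D.toNichols (x * y)) = φ (D.toNichols x) * φ (D.toNichols y)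
  map_counit : ∀ x, Coalgebra.counit (R := k) (φ (D.toNichols x)) =
    TensorAlgebra.algebraMapInv x
  map_comul : ∀ x, Coalgebra.comul (R := k) (φ (D.toNichols x)) =
    TensorProduct.map (φ.toLinearMap ∘ₗ D.toNichols) (φ.toLinearMap ∘ₗ D.toNichols)
      (D.tensorAlgebraComul x)
  map_yetterDrinfeld : D.tensorAlgebra.IsHom DR (φ.toLinearMap ∘ₗ D.toNichols)
  map_grading : ∀ n, Submodule.map (φ.toLinearMap ∘ₗ D.toNichols)
    (LinearMap.range (TensorAlgebra.ι k : V →ₗ[k] TensorAlgebra k V) ^ n) = 𝒜 n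

end YDData

/-- `F : R ≃ R'` is an isomorphism of graded Hopf algebras in the Yetter–Drinfeld category. -/
structure IsGradedBraidedHopfIso {R R' : Type*} [Ring R] [Algebra k R] [Coalgebra k R]
    [Ring R'] [Algebra k R'] [Coalgebra k R'] (D : YDData k H R) (𝒜 : ℕ → Submodule k R)
    (D' : YDData k H R') (𝒜' : ℕ → Submodule k R') (F : R ≃ₐ[k] R') : Prop where
  map_counit : ∀ x, Coalgebra.counit (R := k) (F x) = Coalgebra.counit (R := k) x
  map_comul : ∀ x, Coalgebra.comul (R := k) (F x) =
    TensorProduct.map F.toLinearMap F.toLinearMap (Coalgebra.comul (R := k) x)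
  map_yetterDrinfeld : D.IsHom D' F.toLinearMap
  map_grading : ∀ n, Submodule.map F.toLinearMap (𝒜 n) = 𝒜' n

end TensorAlg

end

/-! Both `p : A(V) → R` and the symmetrizer are graded, so everything happens in one degree `n`. Let
`mₙ : V^{⊗n} → R(n)` be the multiplication. Surjectivity of `p` is generation in degree one
(`IsTOBA.eq_pow`), which follows from the condition on the square of the augmentation ideal by
induction on the degree.

For the kernel, let `∂ = (π ⊗ id) Δ : R → V ⊗ R`, where `π` is the projection onto `R(1) = V`, and
let `∂ₙ : R → V^{⊗n}` be its iterate. Two facts suffice.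

(a) `∂ₙ` is injective on `R(n)` (`IsTOBA.eq_zero_of_iterSkewDer`). This is where the primitives
enter. If `∂x = 0` with `x` of degree at least two, coassociativity gives `(∂ ⊗ id)Δ(x) = 0`; by
induction on the degree all components of `Δ(x)` of bidegree `(i, j)` with `i, j ≥ 1` vanish. Then
`x` is primitive, hence of degree one, hence zero.

(b) `∂ₙ ∘ mₙ = 𝔖ⁿ` (`IsTOBA.iterSkewDer_tensorPowerLift`). Multiplicativity of `Δ` gives the braided
Leibniz rule `∂(vx) = v ⊗ x + (id ⊗ m)(c ⊗ id)(v ⊗ ∂x)`. On a product of `n + 1` vectors it produces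
the operator `1 + σ₀ + σ₀σ₁ + ⋯ + σ₀⋯σₙ₋₁`. The symmetrizer obeys the same recursion, `𝔖ⁿ⁺¹ = (id ⊗
𝔖ⁿ)(1 + σ₀ + ⋯ + σ₀⋯σₙ₋₁)`, because every permutation factors uniquely, with lengths adding, through
the stabilizer of the first point (`symmetrizer_succ`).

Together, `mₙ(t) = 0` if and only if `𝔖ⁿ(t) = 0`. The recursion for `𝔖` requires that `s(w)` not
depend on the reduced word. This is Matsumoto's theorem (`AscWord.prod_map_eq`), applicable because
the braiding satisfies the Yang–Baxter equation (`IsYetterDrinfeld.isYangBaxter`).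

Finally `p` respects action, coaction, counit and comultiplication, as is checked on generators.
Since `ker 𝔖` and the structure of `A(V)` depend only on `V`, two TOBAs with the same `V` are the
same quotient of `A(V)`. -/

/-! ### Matsumoto's theorem for the symmetric group -/

namespace SymmGroup

variable {n : ℕ}

/-- The elementary transposition `(i, i + 1)`. -/
abbrev transposition (i : Idx n) : Equiv.Perm (Fin n) := Equiv.swap i.left i.right

theorem Idx.left_lt_right (i : Idx n) : i.left < i.right := by
  simp [Idx.left, Idx.right]

theorem wordPerm_append (l l' : List (Idx n)) :
    wordPerm (l ++ l') = wordPerm l * wordPerm l' := by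
  simp [wordPerm]

theorem wordPerm_snoc (l : List (Idx n)) (i : Idx n) :
    wordPerm (l ++ [i]) = wordPerm l * transposition i := by
  simp [wordPerm]

/-- The inversions of a permutation. -/
def inversions (w : Equiv.Perm (Fin n)) : Finset (Fin n × Fin n) :=
  Finset.univ.filter fun x => x.1 < x.2 ∧ w x.2 < w x.1

theorem mem_inversions {w : Equiv.Perm (Fin n)} {a b : Fin n} :
    (a, b) ∈ inversions w ↔ a < b ∧ w b < w a := by
  rw [inversions, Finset.mem_filter]
  exact and_iff_right (Finset.mem_univ _)

theorem transposition_val (i : Idx n) (a : Fin n) :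
    (transposition i a : ℕ) = if (a : ℕ) = i.1 then i.1 + 1 else if (a : ℕ) = i.1 + 1 then i.1
      else a := by
  rw [transposition, Equiv.swap_apply_def]
  simp only [Fin.ext_iff, Idx.left, Idx.right]
  split_ifs <;> rfl

/-- Nothing lies between `i` and `i + 1`, so exchanging them affects no other comparison. -/
theorem transposition_lt_iff (i : Idx n) {a b : Fin n} (h : (a, b) ≠ (i.left, i.right))
    (h' : (a, b) ≠ (i.right, i.left)) : transposition i a < transposition i b ↔ a < b := by
  rw [Fin.lt_def, Fin.lt_def, transposition_val, transposition_val]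
  simp only [ne_eq, Prod.mk.injEq, Fin.ext_iff, Idx.left, Idx.right] at h h'
  split_ifs <;> omega

/-- Applying `τᵢ` to both positions carries the inversions of `w` onto those of `w τᵢ`, except for
the one new inversion `(i, i + 1)`. -/
theorem card_inversions_mul_transposition (w : Equiv.Perm (Fin n)) (i : Idx n)
    (h : w i.left < w i.right) :
    (inversions (w * transposition i)).card = (inversions w).card + 1 := by
  have key : inversions (w * transposition i) = insert (i.left, i.right)
      ((inversions w).map
        ((transposition i).prodCongr (transposition i)).toEmbedding) := by
    ext ⟨a, b⟩
    simp only [mem_inversions, Finset.mem_insert, Finset.mem_map_equiv,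
      Equiv.prodCongr_symm, Equiv.symm_swap, Equiv.prodCongr_apply,
      Prod.map, Equiv.Perm.mul_apply]
    by_cases h1 : (a, b) = (i.left, i.right)
    · simp only [Prod.mk.injEq] at h1
      obtain ⟨rfl, rfl⟩ := h1
      simp [i.left_lt_right, h]
    by_cases h2 : (a, b) = (i.right, i.left)
    · simp only [Prod.mk.injEq] at h2
      obtain ⟨rfl, rfl⟩ := h2
      simp [h.le, i.left_lt_right.ne', i.left_lt_right.ne]
    rw [transposition_lt_iff i h1 h2]
    simp [h1]
  rw [key, Finset.card_insert_of_notMem, Finset.card_map]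
  simp [mem_inversions, Finset.mem_map_equiv, i.left_lt_right.le]

theorem mul_transposition_cancel (w : Equiv.Perm (Fin n)) (i : Idx n) :
    w * transposition i * transposition i = w := by
  simp [mul_assoc]

theorem card_inversions_mul_transposition_of_gt (w : Equiv.Perm (Fin n)) (i : Idx n)
    (h : w i.right < w i.left) :
    (inversions (w * transposition i)).card + 1 = (inversions w).card := by
  rw [← card_inversions_mul_transposition _ i (by simpa using h), mul_transposition_cancel]

/-- A word in which every letter increases the number of inversions. -/
inductive AscWord : List (Idx n) → Prop
  | nil : AscWord []
  | snoc {l : List (Idx n)} {i : Idx n} : AscWord l → wordPerm l i.left < wordPerm l i.right →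
      AscWord (l ++ [i])

theorem AscWord.of_snoc {l : List (Idx n)} {i : Idx n} (h : AscWord (l ++ [i])) :
    AscWord l ∧ wordPerm l i.left < wordPerm l i.right := by
  generalize hm : l ++ [i] = m at h
  cases h with
  | nil => simp at hm
  | snoc h h' =>
    obtain ⟨rfl, hi⟩ := List.append_inj' hm rfl
    obtain rfl : i = _ := by simpa using hi
    exact ⟨h, h'⟩

theorem inversions_one : inversions (1 : Equiv.Perm (Fin n)) = ∅ := by
  ext ⟨a, b⟩
  simp only [mem_inversions, Equiv.Perm.one_apply, Finset.notMem_empty, iff_false]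
  exact fun h => lt_asymm h.1 h.2

theorem AscWord.length_eq {l : List (Idx n)} (h : AscWord l) :
    l.length = (inversions (wordPerm l)).card := by
  induction h with
  | nil => simp [wordPerm, inversions_one]
  | snoc _ h ih =>
    rw [wordPerm_snoc, card_inversions_mul_transposition _ _ h, ← ih]
    simp

theorem apply_left_ne_right (w : Equiv.Perm (Fin n)) (i : Idx n) : w i.left ≠ w i.right :=
  fun h => i.left_lt_right.ne (w.injective h)

theorem card_inversions_le_length (l : List (Idx n)) :
    (inversions (wordPerm l)).card ≤ l.length := by
  induction l using List.reverseRecOn with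
  | nil => simp [wordPerm, inversions_one]
  | append_singleton l i ih =>
    rw [wordPerm_snoc, List.length_append, List.length_singleton]
    rcases (apply_left_ne_right (wordPerm l) i).lt_or_gt with h | h
    · rw [card_inversions_mul_transposition _ _ h]; omega
    · have := card_inversions_mul_transposition_of_gt _ _ h; omega

/-- Each letter changes the number of inversions by one, up or down, so a word as long as its number
of inversions never goes down. -/
theorem AscWord.of_length_eq {l : List (Idx n)}
    (h : l.length = (inversions (wordPerm l)).card) : AscWord l := by
  induction l using List.reverseRecOn with
  | nil => exact .nil
  | append_singleton l i ih =>
    rw [wordPerm_snoc, List.length_append, List.length_singleton] at h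
    have hl := card_inversions_le_length l
    rcases (apply_left_ne_right (wordPerm l) i).lt_or_gt with h' | h'
    · rw [card_inversions_mul_transposition _ _ h'] at h
      exact .snoc (ih (by omega)) h'
    · have := card_inversions_mul_transposition_of_gt _ _ h'; omega

theorem eq_one_of_forall_lt (w : Equiv.Perm (Fin n)) (h : ∀ i : Idx n, w i.left < w i.right) :
    w = 1 := by
  cases n with
  | zero => exact Subsingleton.elim _ _
  | succ n =>
    have hw : StrictMono w := Fin.strictMono_iff_lt_succ.2 fun i => h ⟨i, by omega⟩
    exact Equiv.ext (congrFun ((hw.range_inj strictMono_id).1 (by simp)))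

/-- Bubble sort: a permutation other than the identity has a descent, and undoing it removes one
inversion. -/
theorem exists_ascWord (w : Equiv.Perm (Fin n)) : ∃ l, AscWord l ∧ wordPerm l = w := by
  induction hm : (inversions w).card generalizing w with
  | zero =>
    refine ⟨[], .nil, (eq_one_of_forall_lt w fun i => ?_).symm⟩
    refine (apply_left_ne_right w i).lt_or_gt.resolve_right fun h => ?_
    have := card_inversions_mul_transposition_of_gt _ _ h; omega
  | succ m ih =>
    obtain ⟨i, hi⟩ : ∃ i : Idx n, w i.right < w i.left := by
      by_contra! h
      rw [eq_one_of_forall_lt w fun i => (h i).lt_of_ne (apply_left_ne_right w i),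
        inversions_one] at hm
      simp at hm
    obtain ⟨l, hl, hw⟩ := ih (w * transposition i)
      (by have := card_inversions_mul_transposition_of_gt _ _ hi; omega)
    refine ⟨l ++ [i], .snoc hl (by simpa [hw] using hi), ?_⟩
    rw [wordPerm_snoc, hw, mul_transposition_cancel]

/-- The minimal length is the number of inversions, since some ascending word attains it. Minimality
can thus be replaced by the local condition `AscWord`. -/
theorem IsReducedWord.ascWord {w : Equiv.Perm (Fin n)} {l : List (Idx n)}
    (h : IsReducedWord w l) : AscWord l := by
  obtain ⟨rfl, hmin⟩ := h
  obtain ⟨l', hl', hw⟩ := exists_ascWord (wordPerm l)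
  refine .of_length_eq (le_antisymm ?_ (card_inversions_le_length l))
  rw [← hw, ← hl'.length_eq]
  exact hmin _ hw

/-- The relations of the braid group. -/
structure BraidRelations {M : Type*} [Monoid M] (σ : Idx n → M) : Prop where
  comm : ∀ i j : Idx n, i.1 + 1 < j.1 → σ i * σ j = σ j * σ i
  braid : ∀ i j : Idx n, i.1 + 1 = j.1 → σ i * σ j * σ i = σ j * σ i * σ j

/-- A permutation with descents at `i` and at `j ≠ i` has the words `l ++ v` and `l ++ v'`, with
`v` ending in `i`, `v'` ending in `j`, which are related by a braid relation. -/
theorem exists_ascWord_of_two_descents {M : Type*} [Monoid M] {σ : Idx n → M}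
    (hσ : BraidRelations σ) (w : Equiv.Perm (Fin n)) (i j : Idx n) (hij : i.1 < j.1)
    (hi : w i.right < w i.left) (hj : w j.right < w j.left) :
    ∃ l l' : List (Idx n), AscWord (l ++ [i]) ∧ AscWord (l' ++ [j]) ∧
      wordPerm (l ++ [i]) = w ∧ wordPerm (l' ++ [j]) = w ∧
      ((l ++ [i]).map σ).prod = ((l' ++ [j]).map σ).prod := by
  have snoc {l : List (Idx n)} {w : Equiv.Perm (Fin n)} {i : Idx n}
      (h : AscWord l ∧ wordPerm l = w * transposition i) (hi : w i.right < w i.left) :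
      AscWord (l ++ [i]) ∧ wordPerm (l ++ [i]) = w := by
    refine ⟨.snoc h.1 (by simpa [h.2] using hi), ?_⟩
    rw [wordPerm_snoc, h.2, mul_transposition_cancel]
  have fixed (i : Idx n) (a : Fin n) (hl : a.1 ≠ i.1) (hr : a.1 ≠ i.1 + 1) :
      transposition i a = a := by
    ext; rw [transposition_val]; simp [hl, hr]
  rcases Nat.lt_or_eq_of_le (Nat.succ_le_of_lt hij) with hfar | hnear
  · have hc : transposition i * transposition j = transposition j * transposition i := by
      ext a
      simp only [Equiv.Perm.mul_apply, transposition_val]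
      split_ifs <;> omega
    -- Far letters: both descents can be undone independently, and the two words `l j i` and `l i j`
    -- share the prefix `l`.
    obtain ⟨l, hl⟩ := exists_ascWord (w * transposition i * transposition j)
    have h1 : AscWord (l ++ [j]) ∧ wordPerm (l ++ [j]) = w * transposition i := by
      refine snoc hl ?_
      rw [Equiv.Perm.mul_apply, Equiv.Perm.mul_apply, fixed i j.right, fixed i j.left]
      · exact hj
      all_goals simp [Idx.left, Idx.right]; omega
    have h2 : AscWord (l ++ [i]) ∧ wordPerm (l ++ [i]) = w * transposition j := by
      refine snoc ⟨hl.1, by rw [hl.2, mul_assoc, hc, mul_assoc]⟩ ?_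
      rw [Equiv.Perm.mul_apply, Equiv.Perm.mul_apply, fixed j i.right, fixed j i.left]
      · exact hi
      all_goals simp [Idx.left, Idx.right]; omega
    refine ⟨_, _, (snoc h1 hi).1, (snoc h2 hj).1, (snoc h1 hi).2, (snoc h2 hj).2, ?_⟩
    simp [hσ.comm i j hfar]
  · have hlr : j.left = i.right := by ext; simp [Idx.left, Idx.right, ← hnear]
    have hb : transposition i * transposition j * transposition i =
        transposition j * transposition i * transposition j := by
      have hlt := i.left_lt_right
      have hlt' := hlr ▸ j.left_lt_right
      rw [transposition, transposition, hlr,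
        Equiv.swap_mul_swap_mul_swap hlt.ne (hlt.trans hlt').ne, Equiv.swap_comm i.left,
        Equiv.swap_comm i.right j.right,
        Equiv.swap_mul_swap_mul_swap hlt'.ne' (hlt.trans hlt').ne', Equiv.swap_comm]
    have e1 : transposition i j.right = j.right := by
      refine fixed i _ ?_ ?_ <;> simp [Idx.right] <;> omega
    have e2 : transposition j i.left = i.left := by
      refine fixed j _ ?_ ?_ <;> simp [Idx.left] <;> omega
    have e3 : transposition i i.right = i.left := Equiv.swap_apply_right _ _
    have e4 : transposition i i.left = i.right := Equiv.swap_apply_left _ _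
    have e5 : transposition j j.right = i.right := hlr ▸ Equiv.swap_apply_right _ _
    have e6 : transposition j i.right = j.right := hlr ▸ Equiv.swap_apply_left _ _
    rw [hlr] at hj
    -- Adjacent letters: `w` reverses three consecutive positions, so the longest element `τᵢτⱼτᵢ =
    -- τⱼτᵢτⱼ` splits off on the right, giving `l i j i` and `l j i j`.
    obtain ⟨l, hl⟩ := exists_ascWord (w * transposition i * transposition j * transposition i)
    have h1 : AscWord (l ++ [i]) ∧ wordPerm (l ++ [i]) = w * transposition i * transposition j := by
      refine snoc hl ?_
      simp only [Equiv.Perm.mul_apply, e1, e2, e4, e6]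
      exact hj
    have h1' : AscWord (l ++ [i] ++ [j]) ∧ wordPerm (l ++ [i] ++ [j]) = w * transposition i := by
      refine snoc h1 ?_
      simp only [Equiv.Perm.mul_apply, e1, e3, hlr]
      exact hj.trans hi
    have h2 : AscWord (l ++ [j]) ∧ wordPerm (l ++ [j]) = w * transposition j * transposition i := by
      refine snoc ⟨hl.1, by rw [hl.2, mul_assoc, mul_assoc, ← mul_assoc (transposition i), hb]
                            simp only [mul_assoc]⟩ ?_
      simp only [Equiv.Perm.mul_apply, e1, e2, e3, e5, hlr]
      exact hi
    have h2' : AscWord (l ++ [j] ++ [i]) ∧ wordPerm (l ++ [j] ++ [i]) = w * transposition j := by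
      refine snoc h2 ?_
      simp only [Equiv.Perm.mul_apply, e2, e6]
      exact hj.trans hi
    have hj' : w j.right < w j.left := by rwa [hlr]
    refine ⟨_, _, (snoc h1' hi).1, (snoc h2' hj').1, (snoc h1' hi).2, (snoc h2' hj').2, ?_⟩
    have := hσ.braid i j hnear
    simp only [List.map_append, List.map_cons, List.map_nil, List.prod_append, List.prod_singleton,
      mul_assoc] at this ⊢
    rw [this]

/-- Matsumoto's theorem. -/
theorem AscWord.prod_map_eq {M : Type*} [Monoid M] {σ : Idx n → M} (hσ : BraidRelations σ)
    {l l' : List (Idx n)} (hl : AscWord l) (hl' : AscWord l') (h : wordPerm l = wordPerm l') :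
    (l.map σ).prod = (l'.map σ).prod := by
  induction hm : l.length generalizing l l' with
  | zero =>
    have : l'.length = 0 := by rw [hl'.length_eq, ← h, ← hl.length_eq, hm]
    rw [List.length_eq_zero_iff.1 hm, List.length_eq_zero_iff.1 this]
  | succ m ih =>
    have hm' : l'.length = m + 1 := by rw [hl'.length_eq, ← h, ← hl.length_eq, hm]
    have ih_snoc {l l' : List (Idx n)} {i : Idx n} (hl : AscWord (l ++ [i]))
        (hl' : AscWord (l' ++ [i])) (h : wordPerm (l ++ [i]) = wordPerm (l' ++ [i]))
        (hm : (l ++ [i]).length = m + 1) :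
        ((l ++ [i]).map σ).prod = ((l' ++ [i]).map σ).prod := by
      rw [wordPerm_snoc, wordPerm_snoc, mul_left_inj] at h
      simp [ih hl.of_snoc.1 hl'.of_snoc.1 h (by simpa using hm)]
    -- Different last letters are both descents of the permutation. Each word is compared, by
    -- induction, with the word of the braid-related pair that has the same last letter.
    have main {l l' : List (Idx n)} {i j : Idx n} (hl : AscWord (l ++ [i]))
        (hl' : AscWord (l' ++ [j])) (h : wordPerm (l ++ [i]) = wordPerm (l' ++ [j]))
        (hm : (l ++ [i]).length = m + 1) (hm' : (l' ++ [j]).length = m + 1) (hij : i.1 < j.1) :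
        ((l ++ [i]).map σ).prod = ((l' ++ [j]).map σ).prod := by
      obtain ⟨u, u', hu, hu', hw, hw', hp⟩ := exists_ascWord_of_two_descents hσ
        (wordPerm (l ++ [i])) i j hij (by simpa [wordPerm_snoc] using hl.of_snoc.2)
        (by rw [h]; simpa [wordPerm_snoc] using hl'.of_snoc.2)
      rw [ih_snoc hl hu hw.symm hm, hp, ih_snoc hl' hu' (h.symm.trans hw'.symm) hm']
    rcases List.eq_nil_or_concat' l with rfl | ⟨l, i, rfl⟩
    · simp at hm
    rcases List.eq_nil_or_concat' l' with rfl | ⟨l', j, rfl⟩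
    · simp at hm'
    rcases lt_trichotomy i.1 j.1 with hij | hij | hij
    · exact main hl hl' h hm hm' hij
    · obtain rfl := Subtype.ext hij
      exact ih_snoc hl hl' h hm
    · exact (main hl' hl h.symm hm' hm hij).symm

/-- Frees `s(w)` from the arbitrary choice made in `reducedWord`. -/
theorem BraidRelations.prod_reducedWord {M : Type*} [Monoid M] {σ : Idx n → M}
    (hσ : BraidRelations σ) {l : List (Idx n)} (hl : AscWord l) :
    ((reducedWord (wordPerm l)).map σ).prod = (l.map σ).prod :=
  have h := (exists_reducedWord (wordPerm l)).choose_spec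
  AscWord.prod_map_eq hσ h.ascWord hl h.1

/-! ### Minimal coset representatives for the stabilizer of the first point -/

/-- The shift `i ↦ i + 1` of elementary transpositions. -/
def Idx.shift (i : Idx n) : Idx (n + 1) := ⟨i.1 + 1, Nat.succ_lt_succ i.2⟩

/-- The permutation of `{0, …, n}` which fixes `0` and is `u` on `{1, …, n}`. -/
abbrev shiftPerm (u : Equiv.Perm (Fin n)) : Equiv.Perm (Fin (n + 1)) :=
  Equiv.Perm.decomposeFin.symm (0, u)

theorem wordPerm_map_shift (l : List (Idx n)) :
    wordPerm (l.map Idx.shift) = shiftPerm (wordPerm l) := by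
  induction l with
  | nil =>
    ext a
    refine Fin.cases ?_ (fun b => ?_) a <;> simp [wordPerm]
  | cons i l ih =>
    rw [show i :: l = [i] ++ l from rfl, List.map_append, wordPerm_append, wordPerm_append, ih]
    ext a
    refine Fin.cases ?_ (fun b => ?_) a
    · simp [wordPerm, Equiv.swap_apply_def, Fin.ext_iff, Idx.left, Idx.right, Idx.shift]
    · simp only [wordPerm, List.map_cons, List.map_nil, List.prod_singleton,
        Equiv.Perm.mul_apply, Equiv.Perm.decomposeFin_symm_apply_succ, Equiv.swap_self,
        Equiv.refl_apply, Fin.val_succ, transposition_val, Idx.shift, Nat.add_right_cancel_iff]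
      split_ifs <;> rfl

theorem AscWord.map_shift {l : List (Idx n)} (h : AscWord l) : AscWord (l.map Idx.shift) := by
  induction h with
  | nil => exact .nil
  | @snoc l i _ h ih =>
    rw [List.map_append]
    refine .snoc ih ?_
    rw [wordPerm_map_shift, show i.shift.left = i.left.succ from rfl,
      show i.shift.right = i.right.succ from rfl]
    simpa using h

/-- The word `0, 1, …, i - 1`. -/
def initialWord (n i : ℕ) (hi : i ≤ n) : List (Idx (n + 1)) :=
  List.ofFn fun j : Fin i => ⟨j, by omega⟩

theorem initialWord_succ (n i : ℕ) (hi : i + 1 ≤ n) :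
    initialWord n (i + 1) hi = initialWord n i (by omega) ++ [⟨i, by omega⟩] := by
  rw [initialWord, List.ofFn_succ']
  simp [initialWord, List.concat_eq_append]

/-- Splitting off the first letter, rather than the last, is what gives the recursion
`cosetSum_succ`. -/
theorem initialWord_succ' (n i : ℕ) (hi : i ≤ n) :
    initialWord (n + 1) (i + 1) (by omega) =
      ⟨0, by omega⟩ :: (initialWord n i hi).map Idx.shift := by
  simp [initialWord, List.ofFn_succ, List.map_ofFn, Function.comp_def, Idx.shift]

theorem wordPerm_initialWord (n i : ℕ) (hi : i ≤ n) :
    wordPerm (initialWord n i hi) ⟨i, by omega⟩ = 0 := by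
  induction i with
  | zero => simp [initialWord, wordPerm]
  | succ i ih =>
    rw [initialWord_succ, wordPerm_snoc, Equiv.Perm.mul_apply, ← ih (by omega)]
    congr 1
    ext
    simp [transposition_val]

/-- Before the letter `i` is appended, the permutation takes the value `0` at position `i`. This is
the least value, so the next letter is an ascent whatever `l` is. -/
theorem ascWord_shift_append_initialWord {l : List (Idx n)} (hl : AscWord l) (i : ℕ)
    (hi : i ≤ n) : AscWord (l.map Idx.shift ++ initialWord n i hi) := by
  induction i with
  | zero => simpa [initialWord] using hl.map_shift
  | succ i ih =>
    rw [initialWord_succ, ← List.append_assoc]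
    refine .snoc (ih _) ?_
    rw [wordPerm_append, wordPerm_map_shift]
    refine lt_of_le_of_ne ?_ (apply_left_ne_right _ _)
    rw [Idx.left, Equiv.Perm.mul_apply, wordPerm_initialWord]
    simp

/-- The index `i` is recovered as the preimage of `0`, and then `u` by cancellation; surjectivity is
the count `(n + 1)! = (n + 1) · n!`. -/
theorem bijective_shiftPerm_mul_initialWord (n : ℕ) :
    Function.Bijective fun x : Equiv.Perm (Fin n) × Fin (n + 1) =>
      shiftPerm x.1 * wordPerm (initialWord n x.2 (Nat.lt_succ_iff.1 x.2.2)) := by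
  rw [Fintype.bijective_iff_injective_and_card]
  constructor
  · rintro ⟨u, i⟩ ⟨u', i'⟩ h
    simp only at h
    have h0 (u : Equiv.Perm (Fin n)) (i : Fin (n + 1)) :
        (shiftPerm u * wordPerm (initialWord n i (Nat.lt_succ_iff.1 i.2))) i = 0 := by
      rw [Equiv.Perm.mul_apply, wordPerm_initialWord]; simp
    obtain rfl : i = i' := Equiv.injective _ ((h0 u i).trans (h ▸ (h0 u' i').symm))
    rw [mul_left_inj, EmbeddingLike.apply_eq_iff_eq] at h
    simpa using h
  · simp [Fintype.card_perm, Nat.factorial_succ, mul_comm]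

/-- Every permutation of `{0, …, n}` is uniquely a product of a permutation of `{1, …, n}` and of
`τ₀ ⋯ τᵢ₋₁`, and the lengths add up. -/
theorem BraidRelations.sum_reducedWord {M : Type*} [Semiring M] {σ : Idx (n + 1) → M}
    (hσ : BraidRelations σ) :
    ∑ w, ((reducedWord w).map σ).prod =
      (∑ u, ((reducedWord u).map (fun i => σ i.shift)).prod) *
        ∑ i : Fin (n + 1), ((initialWord n i (Nat.lt_succ_iff.1 i.2)).map σ).prod := by
  rw [← (bijective_shiftPerm_mul_initialWord n).sum_comp, Fintype.sum_prod_type,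
    Finset.sum_mul]
  refine Finset.sum_congr rfl fun u _ => ?_
  rw [Finset.mul_sum]
  refine Finset.sum_congr rfl fun i _ => ?_
  have h := (exists_reducedWord u).choose_spec
  change wordPerm (reducedWord u) = u ∧ _ at h
  have hasc : AscWord (reducedWord u) := (exists_reducedWord u).choose_spec.ascWord
  have := hσ.prod_reducedWord (ascWord_shift_append_initialWord hasc i (Nat.lt_succ_iff.1 i.2))
  rw [wordPerm_append, wordPerm_map_shift, h.1] at this
  rw [this, List.map_append, List.prod_append, List.map_map]
  rfl

end SymmGroup

noncomputable section

/-! ### The braiding -/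

section Braiding

variable {k H M N : Type*} [Field k] [Ring H] [HopfAlgebra k H]
  [AddCommGroup M] [Module k M] [AddCommGroup N] [Module k N]

/-- `c ⊗ id` on `M ⊗ (M ⊗ W)`. -/
def braidHead (c : M ⊗[k] M →ₗ[k] M ⊗[k] M) (W : Type*) [AddCommGroup W] [Module k W] :
    M ⊗[k] (M ⊗[k] W) →ₗ[k] M ⊗[k] (M ⊗[k] W) :=
  (TensorProduct.assoc k M M W).toLinearMap ∘ₗ c.rTensor W
    ∘ₗ (TensorProduct.assoc k M M W).symm.toLinearMap

theorem braidHead_tmul (c : M ⊗[k] M →ₗ[k] M ⊗[k] M) {W : Type*} [AddCommGroup W] [Module k W]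
    (a b : M) (w : W) :
    braidHead c W (a ⊗ₜ (b ⊗ₜ w)) = TensorProduct.assoc k M M W (c (a ⊗ₜ b) ⊗ₜ w) := by
  simp [braidHead]

/-- The Yang–Baxter equation `c₁ c₂ c₁ = c₂ c₁ c₂` on `M ⊗ M ⊗ M`. -/
def IsYangBaxter (c : M ⊗[k] M →ₗ[k] M ⊗[k] M) : Prop :=
  braidHead c M ∘ₗ c.lTensor M ∘ₗ braidHead c M = c.lTensor M ∘ₗ braidHead c M ∘ₗ c.lTensor M

namespace YDData

theorem braiding_tmul (D : YDData k H M) (D' : YDData k H N) (m : M) (n : N) :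
    D.braiding D' (m ⊗ₜ n) = (D'.act.flip n).rTensor M (D.coact m) := by
  simp only [braiding, LinearMap.comp_apply, LinearMap.rTensor_tmul, LinearEquiv.coe_coe]
  generalize D.coact m = t
  induction t with
  | zero => simp
  | add x y hx hy => simp only [TensorProduct.add_tmul, map_add, hx, hy]
  | tmul h m => simp

theorem tensor_act_tmul (D : YDData k H M) (D' : YDData k H N) (h : H) (m : M) (n : N) :
    (D.tensor D').act h (m ⊗ₜ n) =
      TensorProduct.map (D.act.flip m) (D'.act.flip n) (Coalgebra.comul (R := k) h) := by
  simp only [tensor, LinearMap.comp_apply]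
  generalize Coalgebra.comul (R := k) h = t
  induction t with
  | zero => simp
  | add x y hx hy => simp only [map_add, LinearMap.add_apply, hx, hy]
  | tmul h m => simp

theorem tensor_coact_tmul (D : YDData k H M) (D' : YDData k H N) (m : M) (n : N) :
    (D.tensor D').coact (m ⊗ₜ n) = (LinearMap.mul' k H).rTensor (M ⊗[k] N)
      (TensorProduct.tensorTensorTensorComm k H M H N (D.coact m ⊗ₜ D'.coact n)) := by
  simp [tensor]

/-- Morphisms of Yetter–Drinfeld modules commute with the braiding. -/
theorem IsHom.map_braiding {D : YDData k H M} {D' : YDData k H N} {f : M →ₗ[k] N}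
    (hf : D.IsHom D' f) (z : M ⊗[k] M) :
    TensorProduct.map f f (D.braiding D z) = D'.braiding D' (TensorProduct.map f f z) := by
  induction z with
  | zero => simp
  | add x y hx hy => simp only [map_add, hx, hy]
  | tmul m n =>
    rw [TensorProduct.map_tmul, braiding_tmul, braiding_tmul, hf.map_coact]
    generalize D.coact m = t
    induction t with
    | zero => simp
    | add x y hx hy => simp only [map_add, hx, hy]
    | tmul h m => simp [hf.map_act]

/-! ### Linearity of the braiding and the Yang–Baxter equation -/

/-- `x ⊗ (y ⊗ z) ↦ (x g z) • l ⊗ y • m`. -/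
def sandwichAct (D : YDData k H M) (g : H) (l m : M) : H ⊗[k] (H ⊗[k] H) →ₗ[k] M ⊗[k] M :=
  TensorProduct.map (D.act.flip l ∘ₗ LinearMap.mul' k H ∘ₗ (LinearMap.mulRight k g).rTensor H)
      (D.act.flip m)
    ∘ₗ (TensorProduct.assoc k H H H).symm.toLinearMap
    ∘ₗ (TensorProduct.comm k H H).toLinearMap.lTensor H

theorem sandwichAct_tmul (D : YDData k H M) (g : H) (l m : M) (x y z : H) :
    D.sandwichAct g l m (x ⊗ₜ (y ⊗ₜ z)) = D.act (x * g * z) l ⊗ₜ D.act y m := by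
  simp [sandwichAct]

theorem twistedAct_tmul (D : YDData k H M) (h g : H) (m : M) :
    D.twistedAct h (g ⊗ₜ m) = (TensorProduct.map (LinearMap.mul' k H ∘ₗ
        TensorProduct.map (LinearMap.mulRight k g) (HopfAlgebra.antipode k)) (D.act.flip m)
      ∘ₗ (TensorProduct.assoc k H H H).symm.toLinearMap
      ∘ₗ (TensorProduct.comm k H H).toLinearMap.lTensor H)
      ((Coalgebra.comul (R := k) (A := H)).lTensor H (Coalgebra.comul (R := k) h)) := by
  simp only [twistedAct, LinearMap.comp_apply]
  generalize (Coalgebra.comul (R := k) (A := H)).lTensor H (Coalgebra.comul (R := k) h) = t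
  induction t with
  | zero => simp
  | add x y hx hy => simp only [map_add, LinearMap.add_apply, hx, hy]
  | tmul a t =>
    induction t with
    | zero => simp
    | add x y hx hy =>
      simp only [TensorProduct.tmul_add, map_add, LinearMap.add_apply, hx, hy]
    | tmul b c => simp [mulAntipode, mul_assoc]

/-- `h₁ ⊗ h₂ ⊗ h₃ ⊗ h₄` computed in two ways. -/
theorem comul_four (h : H) :
    (TensorProduct.assoc k H H H).toLinearMap.lTensor H
      (TensorProduct.assoc k H (H ⊗[k] H) H
        (((Coalgebra.comul (R := k) (A := H)).lTensor H ∘ₗ Coalgebra.comul).rTensor H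
          (Coalgebra.comul (R := k) h))) =
    ((Coalgebra.comul (R := k) (A := H)).lTensor H ∘ₗ Coalgebra.comul).lTensor H
      (Coalgebra.comul (R := k) h) := by
  have h1 (t : (H ⊗[k] H) ⊗[k] H) : TensorProduct.assoc k H (H ⊗[k] H) H
      (((Coalgebra.comul (R := k) (A := H)).lTensor H).rTensor H t) =
      ((Coalgebra.comul (R := k) (A := H)).rTensor H).lTensor H
        (TensorProduct.assoc k H H H t) := by
    induction t with
    | zero => simp
    | add x y hx hy => simp only [map_add, hx, hy]
    | tmul x y =>
      induction x with
      | zero => simp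
      | add x z hx hz => simp only [map_add, TensorProduct.add_tmul, hx, hz]
      | tmul x z => simp
  rw [LinearMap.rTensor_comp_apply, h1, Coalgebra.coassoc_apply, ← LinearMap.lTensor_comp_apply,
    ← LinearMap.lTensor_comp_apply, ← Coalgebra.coassoc]
  rfl

/-- `x ⊗ w ↦ g' • w • l ⊗ m'`, where `g' ⊗ m'` is the twisted action of `x` on `t`. -/
def twistedActAct (D : YDData k H M) (l : M) (t : H ⊗[k] M) : H ⊗[k] H →ₗ[k] M ⊗[k] M :=
  TensorProduct.lift (LinearMap.mk₂ k
    (fun x w => (D.act.flip (D.act w l)).rTensor M (D.twistedAct x t))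
    (by intros; simp only [map_add, LinearMap.add_apply])
    (by intros; simp only [map_smul, LinearMap.smul_apply])
    (by intros; simp only [map_add, LinearMap.add_apply, LinearMap.rTensor_add])
    (by intros; simp only [map_smul, LinearMap.smul_apply, LinearMap.rTensor_smul]))

theorem twistedActAct_tmul (D : YDData k H M) (l : M) (t : H ⊗[k] M) (x w : H) :
    D.twistedActAct l t (x ⊗ₜ w) = (D.act.flip (D.act w l)).rTensor M (D.twistedAct x t) := rfl

/-- For `s = x ⊗ w` both sides are `x₁ g S(x₃) w • l ⊗ x₂ • m`. The right-hand form puts `S(x₃)`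
next to `w`, ready to cancel when `s = Δ(h)`. -/
theorem IsYetterDrinfeld.twistedActAct_eq_sandwichAct {D : YDData k H M}
    (hD : D.IsYetterDrinfeld) (l : M) (g : H) (m : M) (s : H ⊗[k] H) :
    D.twistedActAct l (g ⊗ₜ m) s =
      D.sandwichAct g l m (((LinearMap.mul' k H ∘ₗ
        (HopfAlgebra.antipode k).rTensor H).lTensor H).lTensor H
        ((TensorProduct.assoc k H H H).toLinearMap.lTensor H
        (TensorProduct.assoc k H (H ⊗[k] H) H
        (((Coalgebra.comul (R := k) (A := H)).lTensor H ∘ₗ Coalgebra.comul).rTensor H s)))) := by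
  induction s with
  | zero => simp only [map_zero]
  | add x y hx hy => simp only [map_add, hx, hy]
  | tmul x w =>
    rw [twistedActAct_tmul, twistedAct_tmul, LinearMap.rTensor_tmul,
      LinearMap.comp_apply (LinearMap.lTensor H _)]
    generalize (Coalgebra.comul (R := k) (A := H)).lTensor H (Coalgebra.comul (R := k) x) = q
    induction q with
    | zero => simp only [map_zero, TensorProduct.zero_tmul]
    | add x y hx hy => simp only [map_add, TensorProduct.add_tmul, hx, hy]
    | tmul a q =>
      induction q with
      | zero => simp only [map_zero, TensorProduct.tmul_zero, TensorProduct.zero_tmul]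
      | add x y hx hy =>
        simp only [map_add, TensorProduct.add_tmul, TensorProduct.tmul_add, hx, hy]
      | tmul b c =>
        rw [TensorProduct.assoc_tmul, LinearMap.lTensor_tmul, LinearEquiv.coe_coe,
          TensorProduct.assoc_tmul, LinearMap.lTensor_tmul, LinearMap.lTensor_tmul,
          sandwichAct_tmul]
        simp [mul_assoc, hD.act_mul]

/-- For `t = g ⊗ m` this is `h₁ g S(h₃) h₄ • l ⊗ h₂ • m = h₁ g • l ⊗ h₂ • m`: the antipode in the
Yetter–Drinfeld condition is cancelled by the diagonal action on the other factor. -/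
theorem IsYetterDrinfeld.twistedActAct_comul {D : YDData k H M} (hD : D.IsYetterDrinfeld)
    (l : M) (h : H) (t : H ⊗[k] M) :
    D.twistedActAct l t (Coalgebra.comul (R := k) h) =
      (D.tensor D).act h ((D.act.flip l).rTensor M t) := by
  induction t with
  | zero =>
    simp only [map_zero]
    generalize Coalgebra.comul (R := k) h = s
    induction s with
    | zero => rw [map_zero]
    | add x y hx hy => rw [map_add, hx, hy, add_zero]
    | tmul x y => simp only [twistedActAct_tmul, map_zero]
  | add x y hx hy =>
    rw [map_add, map_add, ← hx, ← hy]
    generalize Coalgebra.comul (R := k) h = s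
    induction s with
    | zero => simp only [map_zero, add_zero]
    | add x y hx hy => rw [map_add, hx, hy, map_add, map_add]; abel
    | tmul x y => simp only [twistedActAct_tmul, map_add]
  | tmul g m =>
    -- The identity `x₁ ⊗ S(x₂) x₃ = x ⊗ 1`, to be used with `x = h₂`.
    have h2 : (LinearMap.mul' k H ∘ₗ (HopfAlgebra.antipode k).rTensor H).lTensor H ∘ₗ
        ((Coalgebra.comul (R := k) (A := H)).lTensor H ∘ₗ Coalgebra.comul) =
        (TensorProduct.mk k H H).flip 1 := by
      ext x
      rw [← LinearMap.comp_assoc, ← LinearMap.lTensor_comp, LinearMap.comp_assoc,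
        HopfAlgebra.mul_antipode_rTensor_comul, LinearMap.lTensor_comp, LinearMap.comp_apply,
        LinearMap.comp_apply, Coalgebra.lTensor_counit_comul]
      simp
    rw [hD.twistedActAct_eq_sandwichAct, comul_four, ← LinearMap.lTensor_comp_apply, h2,
      LinearMap.rTensor_tmul, tensor_act_tmul]
    generalize Coalgebra.comul (R := k) h = s
    induction s with
    | zero => simp only [map_zero]
    | add x y hx hy => simp only [map_add, hx, hy]
    | tmul x y => simp [sandwichAct_tmul, hD.act_mul]

/-- The braiding of a Yetter–Drinfeld module is linear for the diagonal action. -/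
theorem IsYetterDrinfeld.braiding_act {D : YDData k H M} (hD : D.IsYetterDrinfeld) (h : H)
    (z : M ⊗[k] M) :
    D.braiding D ((D.tensor D).act h z) = (D.tensor D).act h (D.braiding D z) := by
  induction z with
  | zero => simp
  | add x y hx hy => simp only [map_add, hx, hy]
  | tmul n l =>
    rw [braiding_tmul, ← hD.twistedActAct_comul, tensor_act_tmul]
    generalize Coalgebra.comul (R := k) h = s
    induction s with
    | zero => simp only [map_zero]
    | add x y hx hy => simp only [map_add, hx, hy]
    | tmul x y => simp [braiding_tmul, hD.coact_act, twistedActAct_tmul]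

/-- The braiding `c_{M, M ⊗ M}` is `(id ⊗ c)(c ⊗ id)`. -/
theorem IsYetterDrinfeld.lTensor_braiding_braidHead {D : YDData k H M} (hD : D.IsYetterDrinfeld)
    (m : M) (z : M ⊗[k] M) :
    (D.braiding D).lTensor M (braidHead (D.braiding D) M (m ⊗ₜ z)) =
      TensorProduct.assoc k M M M (((D.tensor D).act.flip z).rTensor M (D.coact m)) := by
  induction z with
  | zero => simp
  | add x y hx hy =>
    simp only [TensorProduct.tmul_add, map_add, hx, hy, LinearMap.rTensor_add,
      LinearMap.add_apply]
  | tmul n l =>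
    rw [braidHead_tmul, braiding_tmul]
    have h1 (t : H ⊗[k] M) : (D.braiding D).lTensor M
        (TensorProduct.assoc k M M M ((D.act.flip n).rTensor M t ⊗ₜ l)) =
        TensorProduct.map (D.act.flip n) ((D.act.flip l).rTensor M) (D.coact.lTensor H t) := by
      induction t with
      | zero => simp
      | add x y hx hy => simp only [map_add, TensorProduct.add_tmul, hx, hy]
      | tmul x y => simp [braiding_tmul]
    rw [h1, ← LinearMap.comp_apply (LinearMap.lTensor H _), ← hD.coassoc]
    simp only [LinearMap.comp_apply]
    generalize D.coact m = t
    induction t with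
    | zero => simp
    | add x y hx hy => simp only [map_add, hx, hy]
    | tmul h m =>
      simp only [LinearMap.rTensor_tmul, LinearMap.flip_apply, tensor_act_tmul]
      generalize Coalgebra.comul (R := k) h = s
      induction s with
      | zero => simp
      | add x y hx hy => simp only [map_add, TensorProduct.add_tmul, hx, hy]
      | tmul x y => simp

/-- The braiding of a Yetter–Drinfeld module satisfies the Yang–Baxter equation. -/
theorem IsYetterDrinfeld.isYangBaxter {D : YDData k H M} (hD : D.IsYetterDrinfeld) :
    IsYangBaxter (D.braiding D) := by
  refine TensorProduct.ext' fun m z => ?_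
  -- Since `c₂ c₁` sends `m ⊗ z` to `m₍₋₁₎ • z ⊗ m₍₀₎`, the equation becomes `c(m₍₋₁₎ • z) ⊗ m₍₀₎ =
  -- m₍₋₁₎ • c(z) ⊗ m₍₀₎`, which is linearity of `c`.
  simp only [LinearMap.comp_apply, LinearMap.lTensor_tmul, hD.lTensor_braiding_braidHead]
  generalize D.coact m = t
  induction t with
  | zero => simp
  | add x y hx hy => simp only [map_add, hx, hy]
  | tmul h m => simp [braidHead, hD.braiding_act]

end YDData

/-- The Yang–Baxter equation is inherited along embeddings compatible with the braidings. -/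
theorem IsYangBaxter.of_injective {c : M ⊗[k] M →ₗ[k] M ⊗[k] M} {d : N ⊗[k] N →ₗ[k] N ⊗[k] N}
    (hd : IsYangBaxter d) {f : M →ₗ[k] N} (hf : Function.Injective f)
    (h : ∀ z, TensorProduct.map f f (c z) = d (TensorProduct.map f f z)) : IsYangBaxter c := by
  set F := TensorProduct.map f (TensorProduct.map f f)
  have hF : Function.Injective F :=
    TensorProduct.map_injective_of_flat_flat _ _ hf
      (TensorProduct.map_injective_of_flat_flat _ _ hf hf)
  have h1 (z) : F (braidHead c M z) = braidHead d N (F z) := by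
    suffices F ∘ₗ braidHead c M = braidHead d N ∘ₗ F from LinearMap.congr_fun this z
    refine TensorProduct.ext_threefold' fun x y z => ?_
    simp only [F, LinearMap.comp_apply, TensorProduct.map_tmul, braidHead_tmul]
    rw [← TensorProduct.map_tmul f f x y, ← h]
    generalize c (x ⊗ₜ y) = t
    induction t with
    | zero => simp
    | add x y hx hy => simp only [map_add, TensorProduct.add_tmul, hx, hy]
    | tmul h m => simp
  have h2 (z) : F (c.lTensor M z) = d.lTensor N (F z) := by
    induction z with
    | zero => simp
    | add x y hx hy => simp only [map_add, hx, hy]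
    | tmul x y => simp [F, h]
  refine LinearMap.ext fun x => hF ?_
  simp only [LinearMap.comp_apply, h1, h2]
  exact LinearMap.congr_fun hd (F x)

/-- `W` is a spectator: appending a fixed `w` (the map `μ`) intertwines the operators with those on
`M ⊗ M ⊗ M`. -/
theorem IsYangBaxter.braidHead {c : M ⊗[k] M →ₗ[k] M ⊗[k] M} (hc : IsYangBaxter c)
    (W : Type*) [AddCommGroup W] [Module k W] :
    braidHead c (M ⊗[k] W) ∘ₗ (braidHead c W).lTensor M ∘ₗ braidHead c (M ⊗[k] W) =
      (braidHead c W).lTensor M ∘ₗ braidHead c (M ⊗[k] W) ∘ₗ (braidHead c W).lTensor M := by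
  refine TensorProduct.ext' fun m z => ?_
  induction z with
  | zero => simp
  | add x y hx hy => rw [TensorProduct.tmul_add, map_add, map_add, hx, hy]
  | tmul n z =>
    induction z with
    | zero => simp
    | add x y hx hy =>
      rw [TensorProduct.tmul_add, TensorProduct.tmul_add, map_add, map_add, hx, hy]
    | tmul l w =>
      let μ : M ⊗[k] (M ⊗[k] M) →ₗ[k] M ⊗[k] (M ⊗[k] (M ⊗[k] W)) :=
        (((TensorProduct.mk k M W).flip w).lTensor M).lTensor M
      have h1 (t) : _root_.braidHead c (M ⊗[k] W) (μ t) = μ (_root_.braidHead c M t) := by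
        suffices _root_.braidHead c (M ⊗[k] W) ∘ₗ μ = μ ∘ₗ _root_.braidHead c M from
          LinearMap.congr_fun this t
        refine TensorProduct.ext_threefold' fun x y z => ?_
        simp only [μ, LinearMap.comp_apply, LinearMap.lTensor_tmul, LinearMap.flip_apply,
          TensorProduct.mk_apply, braidHead_tmul]
        generalize c (x ⊗ₜ y) = t
        induction t with
        | zero => simp
        | add x y hx hy => simp only [map_add, TensorProduct.add_tmul, hx, hy]
        | tmul h m => simp
      have h2 (t) : (_root_.braidHead c W).lTensor M (μ t) = μ (c.lTensor M t) := by
        suffices (_root_.braidHead c W).lTensor M ∘ₗ μ = μ ∘ₗ c.lTensor M from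
          LinearMap.congr_fun this t
        refine TensorProduct.ext_threefold' fun x y z => ?_
        simp only [μ, LinearMap.comp_apply, LinearMap.lTensor_tmul, LinearMap.flip_apply,
          TensorProduct.mk_apply, braidHead_tmul]
        congr 1
        generalize c (y ⊗ₜ z) = t
        induction t with
        | zero => simp
        | add x y hx hy => simp only [map_add, TensorProduct.add_tmul, hx, hy]
        | tmul h m => simp
      have h3 := congrArg μ (LinearMap.congr_fun hc (m ⊗ₜ (n ⊗ₜ l)))
      simp only [LinearMap.comp_apply, ← h1, ← h2] at h3 ⊢
      simpa [μ] using h3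

/-- Naturality in the spectator factor. It gives the commutation of distant `σᵢ`, and later lets the
multiplication `V^{⊗n} → R` pass through the braiding. -/
theorem braidHead_comp_lTensor_lTensor (c : M ⊗[k] M →ₗ[k] M ⊗[k] M) {W W' : Type*}
    [AddCommGroup W] [Module k W] [AddCommGroup W'] [Module k W'] (f : W →ₗ[k] W') :
    braidHead c W' ∘ₗ (f.lTensor M).lTensor M = (f.lTensor M).lTensor M ∘ₗ braidHead c W := by
  refine TensorProduct.ext_threefold' fun x y z => ?_
  simp only [LinearMap.comp_apply, LinearMap.lTensor_tmul, braidHead_tmul]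
  generalize c (x ⊗ₜ y) = t
  induction t with
  | zero => simp
  | add x y hx hy => simp only [map_add, TensorProduct.add_tmul, hx, hy]
  | tmul h m => simp

end Braiding

/-! ### Braid operators on tensor powers -/

section TensorPowers

variable {k H V : Type*} [Field k] [Ring H] [HopfAlgebra k H] [AddCommGroup V] [Module k V]

/-- The isomorphism `V ⊗ V^{⊗n} ≃ V^{⊗(n+1)}`. -/
def tensorCons (k V : Type*) [Field k] [AddCommGroup V] [Module k V] (n : ℕ) :
    V ⊗[k] (⨂[k]^n V) ≃ₗ[k] ⨂[k]^(n + 1) V :=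
  ((PiTensorProduct.subsingletonEquiv (R := k) (s := fun _ : Fin 1 => V)
      (0 : Fin 1)).symm.rTensor (⨂[k]^n V)).trans
    (TensorPower.mulEquiv.trans (TensorPower.cast k V (Nat.add_comm 1 n)))

theorem tensorCons_tprod {n : ℕ} (v : V) (w : Fin n → V) :
    tensorCons k V n (v ⊗ₜ PiTensorProduct.tprod k w) = PiTensorProduct.tprod k (Fin.cons v w) := by
  rw [tensorCons, LinearEquiv.trans_apply, LinearEquiv.rTensor_tmul,
    PiTensorProduct.subsingletonEquiv_symm_apply, LinearEquiv.trans_apply, ← TensorPower.gMul_def,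
    TensorPower.tprod_mul_tprod, TensorPower.cast_tprod, Fin.append_left_eq_cons]
  rfl

theorem tensorCons_ext {n : ℕ} {X : Type*} [AddCommGroup X] [Module k X]
    {f g : ⨂[k]^(n + 1) V →ₗ[k] X}
    (h : ∀ (v : V) (t : ⨂[k]^n V), f (tensorCons k V n (v ⊗ₜ t)) = g (tensorCons k V n (v ⊗ₜ t))) :
    f = g := by
  have : f ∘ₗ (tensorCons k V n).toLinearMap = g ∘ₗ (tensorCons k V n).toLinearMap :=
    TensorProduct.ext' h
  refine LinearMap.ext fun x => ?_
  obtain ⟨y, rfl⟩ := (tensorCons k V n).surjective x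
  exact LinearMap.congr_fun this y

/-- The endomorphism `id ⊗ f` of `V^{⊗(n+1)}`. -/
def shiftEnd (n : ℕ) : Module.End k (⨂[k]^n V) →ₐ[k] Module.End k (⨂[k]^(n + 1) V) :=
  ((tensorCons k V n).conjAlgEquiv k).toAlgHom.comp (Module.End.lTensorAlgHom k _ V)

theorem shiftEnd_tensorCons {n : ℕ} (f : Module.End k (⨂[k]^n V)) (x : V ⊗[k] (⨂[k]^n V)) :
    shiftEnd n f (tensorCons k V n x) = tensorCons k V n (f.lTensor V x) := by
  simp [shiftEnd]
  rfl

open SymmGroup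

theorem sigma_tprod (D : YDData k H V) {n : ℕ} (i : Idx n) (v : Fin n → V) :
    D.sigma i (PiTensorProduct.tprod k v) =
      insertPair i.left i.right i.left_lt_right.ne v (D.braiding D (v i.left ⊗ₜ v i.right)) :=
  applyAt_tprod _ _ _ _ _

/-- Every generator except `σ₀` comes from one tensor factor fewer, which makes induction on the
tensor power possible. -/
theorem sigma_shift (D : YDData k H V) {n : ℕ} (i : Idx n) :
    D.sigma i.shift = shiftEnd n (D.sigma i) := by
  refine tensorCons_ext fun v t => ?_
  rw [shiftEnd_tensorCons, LinearMap.lTensor_tmul]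
  suffices D.sigma i.shift ∘ₗ (tensorCons k V n).toLinearMap ∘ₗ TensorProduct.mk k V _ v =
      (tensorCons k V n).toLinearMap ∘ₗ TensorProduct.mk k V _ v ∘ₗ D.sigma i from
    LinearMap.congr_fun this t
  ext w
  simp only [LinearMap.compMultilinearMap_apply, LinearMap.comp_apply, TensorProduct.mk_apply,
    LinearEquiv.coe_coe, tensorCons_tprod, sigma_tprod]
  simp only [show i.shift.left = i.left.succ from rfl, show i.shift.right = i.right.succ from rfl,
    Fin.cons_succ]
  generalize D.braiding D (w i.left ⊗ₜ w i.right) = z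
  induction z with
  | zero => simp only [map_zero, TensorProduct.tmul_zero]
  | add x y hx hy => simp only [map_add, TensorProduct.tmul_add, hx, hy]
  | tmul a b => simp only [insertPair_tmul, tensorCons_tprod, Fin.cons_update]

theorem sigma_zero (D : YDData k H V) {n : ℕ} (x : V ⊗[k] (V ⊗[k] (⨂[k]^n V))) :
    D.sigma (⟨0, by omega⟩ : Idx (n + 2))
      (tensorCons k V (n + 1) ((tensorCons k V n).toLinearMap.lTensor V x)) =
    tensorCons k V (n + 1) ((tensorCons k V n).toLinearMap.lTensor V
      (braidHead (D.braiding D) _ x)) := by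
  suffices D.sigma (⟨0, by omega⟩ : Idx (n + 2)) ∘ₗ (tensorCons k V (n + 1)).toLinearMap ∘ₗ
      (tensorCons k V n).toLinearMap.lTensor V =
      (tensorCons k V (n + 1)).toLinearMap ∘ₗ (tensorCons k V n).toLinearMap.lTensor V ∘ₗ
      braidHead (D.braiding D) _ from LinearMap.congr_fun this x
  ext a b w
  simp only [TensorProduct.AlgebraTensorModule.curry_apply, TensorProduct.curry_apply,
    LinearMap.coe_restrictScalars, LinearMap.compMultilinearMap_apply, LinearMap.comp_apply,
    LinearEquiv.coe_coe, LinearMap.lTensor_tmul, braidHead_tmul, tensorCons_tprod,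
    sigma_tprod]
  rw [show (Fin.cons a (Fin.cons b w : Fin (n + 1) → V) : Fin (n + 2) → V)
      (Idx.left (⟨0, by omega⟩ : Idx (n + 2))) = a from rfl,
    show (Fin.cons a (Fin.cons b w : Fin (n + 1) → V) : Fin (n + 2) → V)
      (Idx.right (⟨0, by omega⟩ : Idx (n + 2))) = b from rfl]
  generalize D.braiding D (a ⊗ₜ b) = z
  induction z with
  | zero => simp only [map_zero, TensorProduct.zero_tmul]
  | add x y hx hy => simp only [map_add, TensorProduct.add_tmul, hx, hy]
  | tmul a' b' =>
    simp only [insertPair_tmul, TensorProduct.assoc_tmul, LinearMap.lTensor_tmul,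
      LinearEquiv.coe_coe, tensorCons_tprod]
    congr 1
    rw [show Idx.left (⟨0, by omega⟩ : Idx (n + 2)) = 0 from rfl,
      show Idx.right (⟨0, by omega⟩ : Idx (n + 2)) = Fin.succ 0 from rfl,
      Fin.update_cons_zero, ← Fin.cons_update, Fin.update_cons_zero]

theorem tensorCons_ext_two {n : ℕ} {X : Type*} [AddCommGroup X] [Module k X]
    {f g : ⨂[k]^(n + 2) V →ₗ[k] X}
    (h : ∀ x : V ⊗[k] (V ⊗[k] (⨂[k]^n V)),
      f (tensorCons k V (n + 1) ((tensorCons k V n).toLinearMap.lTensor V x)) =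
      g (tensorCons k V (n + 1) ((tensorCons k V n).toLinearMap.lTensor V x))) :
    f = g := by
  refine LinearMap.ext fun x => ?_
  obtain ⟨y, rfl⟩ := (tensorCons k V (n + 1)).surjective x
  obtain ⟨z, rfl⟩ := ((tensorCons k V n).lTensor V).surjective y
  exact h z

theorem shiftEnd_shiftEnd {n : ℕ} (f : Module.End k (⨂[k]^n V))
    (x : V ⊗[k] (V ⊗[k] (⨂[k]^n V))) :
    shiftEnd (n + 1) (shiftEnd n f)
      (tensorCons k V (n + 1) ((tensorCons k V n).toLinearMap.lTensor V x)) =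
    tensorCons k V (n + 1) ((tensorCons k V n).toLinearMap.lTensor V
      ((f.lTensor V).lTensor V x)) := by
  rw [shiftEnd_tensorCons, ← LinearMap.lTensor_comp_apply, ← LinearMap.lTensor_comp_apply]
  congr 3
  exact LinearMap.ext fun y => shiftEnd_tensorCons f y

theorem sigma_zero_comm (D : YDData k H V) {n : ℕ} (f : Module.End k (⨂[k]^n V)) :
    D.sigma (⟨0, by omega⟩ : Idx (n + 2)) * shiftEnd (n + 1) (shiftEnd n f) =
      shiftEnd (n + 1) (shiftEnd n f) * D.sigma (⟨0, by omega⟩ : Idx (n + 2)) := by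
  refine tensorCons_ext_two fun x => ?_
  simp only [Module.End.mul_apply, shiftEnd_shiftEnd, sigma_zero]
  congr 2
  exact LinearMap.congr_fun (braidHead_comp_lTensor_lTensor (D.braiding D) f) x

theorem sigma_zero_braid {D : YDData k H V} (hD : IsYangBaxter (D.braiding D)) (n : ℕ) :
    D.sigma (⟨0, by omega⟩ : Idx (n + 3)) * D.sigma (⟨1, by omega⟩ : Idx (n + 3)) *
        D.sigma (⟨0, by omega⟩ : Idx (n + 3)) =
      D.sigma (⟨1, by omega⟩ : Idx (n + 3)) * D.sigma (⟨0, by omega⟩ : Idx (n + 3)) *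
        D.sigma (⟨1, by omega⟩ : Idx (n + 3)) := by
  -- With three factors split off, the relation is the Yang–Baxter equation with spectator `V^{⊗n}`.
  let e : V ⊗[k] (V ⊗[k] (V ⊗[k] (⨂[k]^n V))) ≃ₗ[k] ⨂[k]^(n + 3) V :=
    (((tensorCons k V n).lTensor V).lTensor V).trans
      (((tensorCons k V (n + 1)).lTensor V).trans (tensorCons k V (n + 2)))
  have h0 (x) : D.sigma (⟨0, by omega⟩ : Idx (n + 3)) (e x) =
      e (braidHead (D.braiding D) _ x) := by
    refine (sigma_zero D (((tensorCons k V n).toLinearMap.lTensor V).lTensor V x)).trans ?_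
    rw [← LinearMap.comp_apply (braidHead _ _), braidHead_comp_lTensor_lTensor]
    rfl
  have h1 (x) : D.sigma (⟨1, by omega⟩ : Idx (n + 3)) (e x) =
      e ((braidHead (D.braiding D) _).lTensor V x) := by
    refine (LinearMap.congr_fun (sigma_shift D (⟨0, by omega⟩ : Idx (n + 2))) _).trans ?_
    refine (shiftEnd_tensorCons _ _).trans ?_
    simp only [e, LinearEquiv.trans_apply]
    congr 1
    change (D.sigma _).lTensor V ((tensorCons k V (n + 1)).toLinearMap.lTensor V
      (((tensorCons k V n).toLinearMap.lTensor V).lTensor V x)) =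
      (tensorCons k V (n + 1)).toLinearMap.lTensor V
      (((tensorCons k V n).toLinearMap.lTensor V).lTensor V
      ((braidHead (D.braiding D) _).lTensor V x))
    simp only [← LinearMap.lTensor_comp_apply]
    congr 2
    exact LinearMap.ext fun y => sigma_zero D y
  refine LinearMap.ext fun y => ?_
  obtain ⟨x, rfl⟩ := e.surjective y
  simp only [Module.End.mul_apply, h0, h1]
  exact congrArg e (LinearMap.congr_fun (hD.braidHead _) x)

/-- The operators `σᵢ` satisfy the relations of the braid group. -/
theorem braidRelations_sigma {D : YDData k H V} (hD : IsYangBaxter (D.braiding D)) (n : ℕ) :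
    BraidRelations (fun i : Idx n => D.sigma i) := by
  induction n with
  | zero => exact ⟨fun i => absurd i.2 (by omega), fun i => absurd i.2 (by omega)⟩
  | succ n ih =>
    constructor
    · rintro ⟨i, hi⟩ ⟨j, hj⟩ hij
      simp only at hij
      obtain ⟨j, rfl⟩ : ∃ j', j = j' + 1 := ⟨j - 1, by omega⟩
      have ej : D.sigma (⟨j + 1, hj⟩ : Idx (n + 1)) = shiftEnd n (D.sigma ⟨j, by omega⟩) :=
        sigma_shift D (⟨j, by omega⟩ : Idx n)
      cases i with
      | zero =>
        -- Here the second index is at least two, so its generator is a double shift and avoids the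
        -- two factors on which `σ₀` acts.
        obtain ⟨j, rfl⟩ : ∃ j', j = j' + 1 := ⟨j - 1, by omega⟩
        obtain ⟨n, rfl⟩ : ∃ n', n = n' + 1 := ⟨n - 1, by omega⟩
        have ej' : D.sigma (⟨j + 1, by omega⟩ : Idx (n + 1)) =
          shiftEnd n (D.sigma ⟨j, by omega⟩) := sigma_shift D (⟨j, by omega⟩ : Idx n)
        simp only [ej, ej']
        exact sigma_zero_comm D _
      | succ i =>
        have ei : D.sigma (⟨i + 1, hi⟩ : Idx (n + 1)) = shiftEnd n (D.sigma ⟨i, by omega⟩) :=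
          sigma_shift D (⟨i, by omega⟩ : Idx n)
        simp only [ei, ej, ← map_mul]
        exact congrArg _ (ih.comm ⟨i, by omega⟩ ⟨j, by omega⟩ (by simp only; omega))
    · rintro ⟨i, hi⟩ ⟨j, hj⟩ hij
      simp only at hij
      subst hij
      cases i with
      | zero =>
        obtain ⟨n, rfl⟩ : ∃ n', n = n' + 2 := ⟨n - 2, by omega⟩
        exact sigma_zero_braid hD n
      | succ i =>
        have ei : D.sigma (⟨i + 1, hi⟩ : Idx (n + 1)) = shiftEnd n (D.sigma ⟨i, by omega⟩) :=
          sigma_shift D (⟨i, by omega⟩ : Idx n)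
        have ej : D.sigma (⟨i + 1 + 1, hj⟩ : Idx (n + 1)) =
          shiftEnd n (D.sigma ⟨i + 1, by omega⟩) := sigma_shift D (⟨i + 1, by omega⟩ : Idx n)
        simp only [ei, ej, ← map_mul]
        exact congrArg _ (ih.braid ⟨i, by omega⟩ ⟨i + 1, by omega⟩ rfl)

/-! ### Factorization of the quantum symmetrizer -/

/-- `1 + σ₀ + σ₀ σ₁ + ⋯ + σ₀ ⋯ σₙ₋₁` on `V^{⊗(n+1)}`. -/
def cosetSum (D : YDData k H V) (n : ℕ) : Module.End k (⨂[k]^(n + 1) V) :=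
  ∑ i : Fin (n + 1), ((initialWord n i (Nat.lt_succ_iff.1 i.2)).map D.sigma).prod

theorem cosetSum_zero (D : YDData k H V) : cosetSum D 0 = 1 := by
  simp [cosetSum, initialWord]

/-- Every nonempty initial word is `0` followed by the shift of a shorter one. This shape matches
the braided Leibniz rule `IsTOBA.skewDer_mul`. -/
theorem cosetSum_succ (D : YDData k H V) (n : ℕ) :
    cosetSum D (n + 1) =
      1 + D.sigma (⟨0, by omega⟩ : Idx (n + 2)) * shiftEnd (n + 1) (cosetSum D n) := by
  rw [cosetSum, Fin.sum_univ_succ]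
  refine congrArg₂ (· + ·) ?_ ?_
  · simp [initialWord]
  · rw [cosetSum, map_sum, Finset.mul_sum]
    refine Finset.sum_congr rfl fun i _ => ?_
    rw [map_list_prod, List.map_map]
    change ((initialWord (n + 1) (i + 1) _).map D.sigma).prod = _
    rw [initialWord_succ' n i (Nat.lt_succ_iff.1 i.2), List.map_cons, List.prod_cons,
      List.map_map]
    congr 3
    exact funext fun j => sigma_shift D j

theorem symmetrizer_zero (D : YDData k H V) : D.symmetrizer 0 = 1 := by
  have h (l : List (Idx 0)) : l = [] := by
    cases l with
    | nil => rfl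
    | cons i _ => exact absurd i.2 (by omega)
  simp [YDData.symmetrizer, YDData.braidLift, h]

/-- `𝔖ⁿ⁺¹ = (id ⊗ 𝔖ⁿ) (1 + σ₀ + σ₀ σ₁ + ⋯ + σ₀ ⋯ σₙ₋₁)`. -/
theorem symmetrizer_succ {D : YDData k H V} (hD : IsYangBaxter (D.braiding D)) (n : ℕ) :
    D.symmetrizer (n + 1) = shiftEnd n (D.symmetrizer n) * cosetSum D n := by
  refine (braidRelations_sigma hD (n + 1)).sum_reducedWord.trans ?_
  rw [YDData.symmetrizer, map_sum]
  refine congrArg (· * _) (Finset.sum_congr rfl fun u _ => ?_)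
  rw [YDData.braidLift, map_list_prod, List.map_map]
  congr 2
  exact funext fun j => sigma_shift D j

end TensorPowers

/-! ### Homogeneous components -/

section Graded

variable {k R : Type*} [Field k] [AddCommGroup R] [Module k R] {𝒜 : ℕ → Submodule k R}

/-- The projection to the homogeneous component of degree `n`. -/
def gradedProj (h : DirectSum.IsInternal 𝒜) (n : ℕ) : R →ₗ[k] R :=
  (𝒜 n).subtype ∘ₗ DirectSum.component k ℕ (fun i => 𝒜 i) n ∘ₗ
    (LinearEquiv.ofBijective (DirectSum.coeLinearMap 𝒜) h).symm.toLinearMap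

theorem gradedProj_mem (h : DirectSum.IsInternal 𝒜) (n : ℕ) (x : R) : gradedProj h n x ∈ 𝒜 n :=
  Subtype.coe_prop _

theorem ofBijective_symm_of_mem (h : DirectSum.IsInternal 𝒜) {n : ℕ} {x : R} (hx : x ∈ 𝒜 n) :
    (LinearEquiv.ofBijective (DirectSum.coeLinearMap 𝒜) h).symm x =
      DirectSum.lof k ℕ (fun i => 𝒜 i) n ⟨x, hx⟩ := by
  rw [LinearEquiv.symm_apply_eq]
  exact (DirectSum.coeLinearMap_lof 𝒜 n ⟨x, hx⟩).symm

theorem gradedProj_of_mem (h : DirectSum.IsInternal 𝒜) {n : ℕ} {x : R} (hx : x ∈ 𝒜 n) :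
    gradedProj h n x = x := by
  simp [gradedProj, ofBijective_symm_of_mem h hx, DirectSum.component.lof_self]

theorem gradedProj_of_mem_ne (h : DirectSum.IsInternal 𝒜) {m n : ℕ} {x : R} (hx : x ∈ 𝒜 m)
    (hmn : m ≠ n) : gradedProj h n x = 0 := by
  simp [gradedProj, ofBijective_symm_of_mem h hx, DirectSum.component.of, hmn]

theorem eq_zero_of_gradedProj (h : DirectSum.IsInternal 𝒜) {x : R}
    (hx : ∀ n, gradedProj h n x = 0) : x = 0 := by
  refine (LinearEquiv.ofBijective (DirectSum.coeLinearMap 𝒜) h).symm.map_eq_zero_iff.1 ?_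
  exact DirectSum.ext_component k fun n => Subtype.ext (hx n)

theorem DirectSum.IsInternal.linearMap_ext (h : DirectSum.IsInternal 𝒜) {X : Type*}
    [AddCommGroup X] [Module k X] {f g : R →ₗ[k] X} (hfg : ∀ n, ∀ x ∈ 𝒜 n, f x = g x) :
    f = g := by
  have : ⨆ n, 𝒜 n ≤ LinearMap.eqLocus f g := iSup_le fun n x hx => hfg n x hx
  rw [h.submodule_iSup_eq_top] at this
  exact LinearMap.ext fun x => this trivial

/-- Over a field `f|_A ⊗ id` stays injective, and `(P ⊗ id)(t)` comes from `A ⊗ Y`. This is how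
injectivity in one degree is applied to one leg of a tensor. -/
theorem rTensor_eq_zero_of_injOn {X Y : Type*} [AddCommGroup X] [Module k X] [AddCommGroup Y]
    [Module k Y] {A : Submodule k R} {f : R →ₗ[k] X} (hf : ∀ x ∈ A, f x = 0 → x = 0)
    {P : R →ₗ[k] R} (hP : ∀ x, P x ∈ A) {t : R ⊗[k] Y}
    (h : f.rTensor Y (P.rTensor Y t) = 0) : P.rTensor Y t = 0 := by
  have hinj : Function.Injective ((f ∘ₗ A.subtype).rTensor Y) :=
    Module.Flat.rTensor_preserves_injective_linearMap _
      ((injective_iff_map_eq_zero _).2 fun x hx => Subtype.ext (hf x x.2 hx))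
  have hP' : P = A.subtype ∘ₗ LinearMap.codRestrict A P hP := rfl
  rw [hP', LinearMap.rTensor_comp_apply] at h ⊢
  rw [← LinearMap.rTensor_comp_apply] at h
  rw [hinj (h.trans (map_zero _).symm), map_zero]

theorem lTensor_eq_zero_of_injOn {X Y : Type*} [AddCommGroup X] [Module k X] [AddCommGroup Y]
    [Module k Y] {A : Submodule k R} {f : R →ₗ[k] X} (hf : ∀ x ∈ A, f x = 0 → x = 0)
    {P : R →ₗ[k] R} (hP : ∀ x, P x ∈ A) {t : Y ⊗[k] R}
    (h : f.lTensor Y (P.lTensor Y t) = 0) : P.lTensor Y t = 0 := by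
  have hinj : Function.Injective ((f ∘ₗ A.subtype).lTensor Y) :=
    Module.Flat.lTensor_preserves_injective_linearMap _
      ((injective_iff_map_eq_zero _).2 fun x hx => Subtype.ext (hf x x.2 hx))
  have hP' : P = A.subtype ∘ₗ LinearMap.codRestrict A P hP := rfl
  rw [hP', LinearMap.lTensor_comp_apply] at h ⊢
  rw [← LinearMap.lTensor_comp_apply] at h
  rw [hinj (h.trans (map_zero _).symm), map_zero]

end Graded

/-! ### Graded braided Hopf algebras -/

section BraidedHopf

variable {k H R : Type*} [Field k] [Ring H] [HopfAlgebra k H] [Ring R] [Algebra k R]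

theorem YDData.braidedMul_tmul (D : YDData k H R) (a b a' b' : R) :
    D.braidedMul ((a ⊗ₜ b) ⊗ₜ (a' ⊗ₜ b')) =
      TensorProduct.map (LinearMap.mulLeft k a) (LinearMap.mulRight k b')
        (D.braiding D (b ⊗ₜ a')) := by
  simp only [braidedMul, LinearMap.comp_apply, LinearEquiv.coe_coe, TensorProduct.assoc_tmul,
    LinearMap.lTensor_tmul, TensorProduct.assoc_symm_tmul, LinearMap.rTensor_tmul]
  generalize D.braiding D (b ⊗ₜ a') = t
  induction t with
  | zero => simp
  | add x y hx hy => simp only [map_add, TensorProduct.add_tmul, TensorProduct.tmul_add, hx, hy]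
  | tmul x y => simp

variable [Coalgebra k R] {D : YDData k H R} {𝒜 : ℕ → Submodule k R}

theorem IsBraidedHopfAlgebra.braiding_one_tmul (hR : IsBraidedHopfAlgebra D) (a : R) :
    D.braiding D (1 ⊗ₜ a) = a ⊗ₜ 1 := by
  have h := hR.unit_hom.map_coact 1
  rw [YDData.braiding_tmul]
  simp only [Algebra.linearMap_apply, map_one] at h
  rw [h]
  simp [YDData.unit, hR.yetterDrinfeld.act_one]

namespace IsGradedBraidedHopfAlgebra

/-- Let `e` be the degree-zero component of `1`. Comparing components of degree `n` in `1 · x = x`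
gives `e x = x` for homogeneous `x`, hence `e = 1`. -/
theorem one_mem (hR : IsGradedBraidedHopfAlgebra D 𝒜) : (1 : R) ∈ 𝒜 0 := by
  have h : LinearMap.mulLeft k (gradedProj hR.isInternal 0 1) = LinearMap.id := by
    refine hR.isInternal.linearMap_ext fun n x hx => ?_
    have h1 : LinearMap.mulRight k x ∘ₗ gradedProj hR.isInternal 0 =
        gradedProj hR.isInternal n ∘ₗ LinearMap.mulRight k x := by
      refine hR.isInternal.linearMap_ext fun m y hy => ?_
      have hyx := hR.mul_mem m n y hy x hx
      rcases eq_or_ne m 0 with rfl | hm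
      · rw [zero_add] at hyx
        simp [gradedProj_of_mem _ hy, gradedProj_of_mem _ hyx]
      · simp [gradedProj_of_mem_ne _ hy hm,
          gradedProj_of_mem_ne (n := n) hR.isInternal hyx (by omega)]
    have h2 := LinearMap.congr_fun h1 1
    simpa [gradedProj_of_mem _ hx] using h2
  have h1 := LinearMap.congr_fun h 1
  simp only [LinearMap.mulLeft_apply, mul_one, LinearMap.id_apply] at h1
  rw [← h1]
  exact gradedProj_mem _ _ _

/-- Linear maps that agree on `R(i) ⊗ R(j)` for `i + j = n` agree on `Δ(R(n))`. -/
theorem comul_ext (hR : IsGradedBraidedHopfAlgebra D 𝒜) {X : Type*} [AddCommGroup X] [Module k X]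
    {L L' : R ⊗[k] R →ₗ[k] X} {n : ℕ}
    (h : ∀ i j, i + j = n → ∀ a ∈ 𝒜 i, ∀ b ∈ 𝒜 j, L (a ⊗ₜ b) = L' (a ⊗ₜ b)) {x : R}
    (hx : x ∈ 𝒜 n) : L (Coalgebra.comul x) = L' (Coalgebra.comul x) := by
  have : (⨆ (i : ℕ) (j : ℕ) (_ : i + j = n),
      LinearMap.range (TensorProduct.map (𝒜 i).subtype (𝒜 j).subtype)) ≤
      LinearMap.eqLocus L L' := by
    refine iSup_le fun i => iSup_le fun j => iSup_le fun hij => ?_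
    rintro _ ⟨z, rfl⟩
    induction z with
    | zero => rw [map_zero]; exact zero_mem _
    | add x y hx hy => rw [map_add]; exact add_mem hx hy
    | tmul a b => exact h i j hij a a.2 b b.2
  exact this (hR.comul_mem n x hx)

end IsGradedBraidedHopfAlgebra

namespace IsTOBA

theorem nontrivial (hR : IsTOBA D 𝒜) : Nontrivial R := by
  obtain ⟨e⟩ := hR.zero_equiv
  have := e.toEquiv.nontrivial
  exact (Submodule.injective_subtype (𝒜 0)).nontrivial

/-- `R(0)` is one-dimensional and contains `1 ≠ 0`; the scalar is read off from `ε(1) = 1`. -/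
theorem eq_counit_smul_one (hR : IsTOBA D 𝒜) {x : R} (hx : x ∈ 𝒜 0) : x = Coalgebra.counit (R := k)
    x • (1 : R) := by
  obtain ⟨e⟩ := hR.zero_equiv
  have := hR.nontrivial
  have h1 : e ⟨1, hR.one_mem⟩ ≠ 0 := by
    rw [ne_eq, e.map_eq_zero_iff, Subtype.ext_iff]
    exact one_ne_zero
  have h2 : (⟨x, hx⟩ : 𝒜 0) = (e ⟨x, hx⟩ / e ⟨1, hR.one_mem⟩) • ⟨1, hR.one_mem⟩ := by
    apply e.injective
    rw [map_smul, smul_eq_mul, div_mul_cancel₀ _ h1]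
  obtain ⟨c, hc⟩ : ∃ c : k, x = c • (1 : R) := ⟨_, congrArg Subtype.val h2⟩
  rw [hc, map_smul, hR.counit_one, smul_eq_mul, mul_one]

theorem comul_of_mem_one (hR : IsTOBA D 𝒜) {x : R} (hx : x ∈ 𝒜 1) :
    Coalgebra.comul (R := k) x = 1 ⊗ₜ x + x ⊗ₜ 1 := by
  rw [← hR.primitives_eq] at hx
  exact hx

theorem counit_of_mem_one (hR : IsTOBA D 𝒜) {x : R} (hx : x ∈ 𝒜 1) : Coalgebra.counit (R := k) x =
    0 := by
  have := hR.nontrivial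
  have h := Coalgebra.lTensor_counit_comul (R := k) x
  rw [hR.comul_of_mem_one hx, map_add, LinearMap.lTensor_tmul, LinearMap.lTensor_tmul,
    hR.counit_one, add_eq_right] at h
  have h' := congrArg (TensorProduct.rid k R) h
  rw [TensorProduct.rid_tmul, map_zero] at h'
  simpa using h'

theorem pow_le (hR : IsTOBA D 𝒜) (n : ℕ) : 𝒜 1 ^ n ≤ 𝒜 n := by
  induction n with
  | zero =>
    rw [pow_zero, Submodule.one_le]
    exact hR.one_mem
  | succ n ih =>
    rw [pow_succ, Submodule.mul_le]
    exact fun x hx y hy => hR.mul_mem n 1 x (ih hx) y hy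

/-- A TOBA is generated in degree one. -/
theorem eq_pow (hR : IsTOBA D 𝒜) (n : ℕ) : 𝒜 n = 𝒜 1 ^ n := by
  refine le_antisymm ?_ (hR.pow_le n)
  induction n using Nat.strong_induction_on with
  | _ n ih =>
    match n with
    | 0 =>
      intro x hx
      rw [hR.eq_counit_smul_one hx]
      exact Submodule.smul_mem _ _ (by rw [pow_zero]; exact Submodule.one_le.1 le_rfl)
    | 1 => rw [pow_one]
    | n + 2 =>
      -- For `x`, `y` homogeneous of positive degrees `i`, `j`, the degree `n + 2` component of `xy`
      -- is zero unless `i + j = n + 2`; then `i, j < n + 2`, and induction puts `xy` in `R(1)^i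
      -- R(1)^j`.
      have key : (⨆ i ≥ 1, 𝒜 i) * (⨆ i ≥ 1, 𝒜 i) ≤
          (𝒜 1 ^ (n + 2)).comap (gradedProj hR.isInternal (n + 2)) := by
        simp only [Submodule.iSup_mul, Submodule.mul_iSup, iSup_le_iff, Submodule.mul_le]
        intro j hj i hi x hx y hy
        rw [Submodule.mem_comap]
        by_cases hij : i + j = n + 2
        · have hxy := Submodule.mul_mem_mul (ih i (by omega) hx) (ih j (by omega) hy)
          rw [← pow_add, hij] at hxy
          rwa [gradedProj_of_mem _ (hR.pow_le _ hxy)]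
        · rw [gradedProj_of_mem_ne _ (hR.mul_mem i j x hx y hy) hij]
          exact zero_mem _
      rw [hR.sq_augmentation] at key
      intro x hx
      have := key (Submodule.mem_iSup_of_mem (n + 2) (Submodule.mem_iSup_of_mem (by omega) hx))
      rwa [Submodule.mem_comap, gradedProj_of_mem _ hx] at this

theorem counit_of_mem_succ (hR : IsTOBA D 𝒜) {n : ℕ} {x : R} (hx : x ∈ 𝒜 (n + 1)) :
    Coalgebra.counit (R := k) x = 0 := by
  rw [hR.eq_pow, pow_succ] at hx
  refine Submodule.mul_induction_on hx (fun a _ b hb => ?_) fun a b ha hb => ?_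
  · rw [hR.counit_mul, hR.counit_of_mem_one hb, mul_zero]
  · rw [map_add, ha, hb, add_zero]

/-- Turns the counit axioms into the values `1 ⊗ x` and `x ⊗ 1` of the extreme components of `Δ(x)`.
-/
theorem gradedProj_zero (hR : IsTOBA D 𝒜) (x : R) :
    gradedProj hR.isInternal 0 x = Coalgebra.counit (R := k) x • (1 : R) := by
  suffices gradedProj hR.isInternal 0 = (Coalgebra.counit (R := k) (A := R)).smulRight 1 from
    LinearMap.congr_fun this x
  refine hR.isInternal.linearMap_ext fun n x hx => ?_
  rw [LinearMap.smulRight_apply]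
  cases n with
  | zero => rw [gradedProj_of_mem _ hx]; exact hR.eq_counit_smul_one hx
  | succ n => rw [gradedProj_of_mem_ne _ hx (by omega), hR.counit_of_mem_succ hx, zero_smul]

theorem gradedProj_act (hR : IsTOBA D 𝒜) (n : ℕ) (h : H) (x : R) :
    gradedProj hR.isInternal n (D.act h x) = D.act h (gradedProj hR.isInternal n x) := by
  suffices gradedProj hR.isInternal n ∘ₗ D.act h = D.act h ∘ₗ gradedProj hR.isInternal n from
    LinearMap.congr_fun this x
  refine hR.isInternal.linearMap_ext fun m x hx => ?_
  have hx' := (hR.isSub m).act_mem h x hx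
  rcases eq_or_ne m n with rfl | hm
  · simp [gradedProj_of_mem _ hx, gradedProj_of_mem _ hx']
  · simp [gradedProj_of_mem_ne _ hx hm, gradedProj_of_mem_ne _ hx' hm]

theorem rTensor_gradedProj_zero_comul (hR : IsTOBA D 𝒜) (x : R) :
    (gradedProj hR.isInternal 0).rTensor R (Coalgebra.comul x) = 1 ⊗ₜ[k] x := by
  have : gradedProj hR.isInternal 0 =
      (LinearMap.toSpanSingleton k R 1) ∘ₗ Coalgebra.counit (R := k) (A := R) :=
    LinearMap.ext fun x => hR.gradedProj_zero x
  rw [this, LinearMap.rTensor_comp_apply, Coalgebra.rTensor_counit_comul]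
  simp

theorem lTensor_gradedProj_zero_comul (hR : IsTOBA D 𝒜) (x : R) :
    (gradedProj hR.isInternal 0).lTensor R (Coalgebra.comul x) = x ⊗ₜ[k] 1 := by
  have : gradedProj hR.isInternal 0 =
      (LinearMap.toSpanSingleton k R 1) ∘ₗ Coalgebra.counit (R := k) (A := R) :=
    LinearMap.ext fun x => hR.gradedProj_zero x
  rw [this, LinearMap.lTensor_comp_apply, Coalgebra.lTensor_counit_comul]
  simp

/-- An element of degree at least two is zero if `Δ(x)` has no components of degree `(i, j)` with
`i, j ≥ 1`. -/
theorem eq_zero_of_rTensor_comul_eq_zero (hR : IsTOBA D 𝒜) {n : ℕ} {x : R} (hx : x ∈ 𝒜 (n + 1))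
    (h : ∀ i < n, (gradedProj hR.isInternal (i + 1)).rTensor R (Coalgebra.comul x) = 0)
    (hn : n ≠ 0) : x = 0 := by
  set P := gradedProj hR.isInternal
  -- `Δ(x)` splits into its bidegrees `(0, n + 1)`, `(n + 1, 0)` and `(i + 1, n - i)` for `i < n`.
  -- Using the second leg for `(n + 1, 0)` lets both extremes be computed by the counit.
  have h1 : LinearMap.id (R := k) (Coalgebra.comul x) =
      ((P 0).rTensor R + (P 0).lTensor R + ∑ i ∈ Finset.range n, (P (i + 1)).rTensor R :
        R ⊗[k] R →ₗ[k] R ⊗[k] R) (Coalgebra.comul x) := by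
    refine hR.comul_ext (fun i j hij a ha b hb => ?_) hx
    simp only [LinearMap.id_apply, LinearMap.add_apply, LinearMap.rTensor_tmul,
      LinearMap.lTensor_tmul, LinearMap.sum_apply]
    rcases i with _ | i
    · rw [gradedProj_of_mem _ ha, gradedProj_of_mem_ne _ hb (by omega), TensorProduct.tmul_zero,
        Finset.sum_eq_zero, add_zero, add_zero]
      intro i _
      rw [gradedProj_of_mem_ne _ ha (by omega), TensorProduct.zero_tmul]
    rw [gradedProj_of_mem_ne _ ha (by omega), TensorProduct.zero_tmul, zero_add]
    rcases j with _ | j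
    · rw [gradedProj_of_mem _ hb, Finset.sum_eq_zero, add_zero]
      intro l hl
      rw [Finset.mem_range] at hl
      rw [gradedProj_of_mem_ne _ ha (by omega), TensorProduct.zero_tmul]
    · rw [gradedProj_of_mem_ne _ hb (by omega), TensorProduct.tmul_zero, zero_add,
        Finset.sum_eq_single i, gradedProj_of_mem _ ha]
      · intro l _ hl
        rw [gradedProj_of_mem_ne _ ha (by omega), TensorProduct.zero_tmul]
      · intro hi
        rw [Finset.mem_range] at hi
        omega
  have h2 : x ∈ 𝒜 1 := by
    rw [← hR.primitives_eq]
    change Coalgebra.comul (R := k) x = 1 ⊗ₜ x + x ⊗ₜ 1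
    rw [LinearMap.id_apply] at h1
    rw [h1, LinearMap.add_apply, LinearMap.add_apply, hR.rTensor_gradedProj_zero_comul,
      hR.lTensor_gradedProj_zero_comul, LinearMap.sum_apply, Finset.sum_eq_zero, add_zero]
    exact fun i hi => h i (Finset.mem_range.1 hi)
  rw [← gradedProj_of_mem hR.isInternal hx, gradedProj_of_mem_ne _ h2 (by omega)]

end IsTOBA

end BraidedHopf

/-! ### Skew derivations and the kernel of `A(V) → R` -/

section Kernel

variable {k H R V : Type*} [Field k] [Ring H] [HopfAlgebra k H] [Ring R] [Algebra k R]
  [AddCommGroup V] [Module k V] {D : YDData k H R} {𝒜 : ℕ → Submodule k R}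
  {DV : YDData k H V} {j : V →ₗ[k] R}

/-- `j` identifies the Yetter–Drinfeld module `V` with `R(1)`. -/
structure IsDegreeOne (D : YDData k H R) (𝒜 : ℕ → Submodule k R) (DV : YDData k H V)
    (j : V →ₗ[k] R) : Prop where
  injective : Function.Injective j
  range_eq : LinearMap.range j = 𝒜 1
  isHom : DV.IsHom D j

theorem IsDegreeOne.mem (hj : IsDegreeOne D 𝒜 DV j) (v : V) : j v ∈ 𝒜 1 := by
  rw [← hj.range_eq]
  exact ⟨v, rfl⟩

/-- Inherited from `R`, so the Yetter–Drinfeld axioms need not be checked on `V` itself. -/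
theorem IsDegreeOne.isYangBaxter (hj : IsDegreeOne D 𝒜 DV j) (hD : D.IsYetterDrinfeld) :
    IsYangBaxter (DV.braiding DV) :=
  hD.isYangBaxter.of_injective hj.injective hj.isHom.map_braiding

theorem IsDegreeOne.exists_proj (hj : IsDegreeOne D 𝒜 DV j) (h : DirectSum.IsInternal 𝒜) :
    ∃ π : R →ₗ[k] V, j ∘ₗ π = gradedProj h 1 := by
  refine ⟨(LinearEquiv.ofInjective j hj.injective).symm.toLinearMap ∘ₗ
    LinearMap.codRestrict _ (gradedProj h 1) fun x => hj.range_eq ▸ gradedProj_mem h 1 x, ?_⟩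
  ext x
  have := LinearEquiv.apply_symm_apply (LinearEquiv.ofInjective j hj.injective)
    (LinearMap.codRestrict _ (gradedProj h 1) (fun x => hj.range_eq ▸ gradedProj_mem h 1 x) x)
  exact congrArg Subtype.val this

/-- The projection `R → R(1) = V`. -/
def IsDegreeOne.proj (hj : IsDegreeOne D 𝒜 DV j) (h : DirectSum.IsInternal 𝒜) : R →ₗ[k] V :=
  (hj.exists_proj h).choose

theorem IsDegreeOne.apply_proj (hj : IsDegreeOne D 𝒜 DV j) (h : DirectSum.IsInternal 𝒜) (x : R) :
    j (hj.proj h x) = gradedProj h 1 x :=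
  LinearMap.congr_fun (hj.exists_proj h).choose_spec x

theorem IsDegreeOne.proj_apply (hj : IsDegreeOne D 𝒜 DV j) (h : DirectSum.IsInternal 𝒜) (v : V) :
    hj.proj h (j v) = v :=
  hj.injective (by rw [hj.apply_proj, gradedProj_of_mem _ (hj.mem v)])

theorem IsDegreeOne.proj_of_mem_ne (hj : IsDegreeOne D 𝒜 DV j) (h : DirectSum.IsInternal 𝒜)
    {n : ℕ} (hn : n ≠ 1) {x : R} (hx : x ∈ 𝒜 n) : hj.proj h x = 0 :=
  hj.injective (by rw [hj.apply_proj, gradedProj_of_mem_ne _ hx hn, map_zero])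

/-- The map `V^{⊗n} → R`, `v₁ ⊗ ⋯ ⊗ vₙ ↦ j(v₁) ⋯ j(vₙ)`. -/
def tensorPowerLift (j : V →ₗ[k] R) (n : ℕ) : ⨂[k]^n V →ₗ[k] R :=
  (TensorAlgebra.lift k j).toLinearMap ∘ₗ TensorPower.toTensorAlgebra

theorem tensorPowerLift_zero (j : V →ₗ[k] R) :
    tensorPowerLift j 0 (PiTensorProduct.tprod k Fin.elim0) = 1 := by
  simp [tensorPowerLift, TensorAlgebra.tprod_apply]

theorem tensorPowerLift_tensorCons (j : V →ₗ[k] R) (n : ℕ) (x : V ⊗[k] (⨂[k]^n V)) :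
    tensorPowerLift j (n + 1) (tensorCons k V n x) =
      (LinearMap.mul' k R ∘ₗ j.rTensor R) ((tensorPowerLift j n).lTensor V x) := by
  suffices tensorPowerLift j (n + 1) ∘ₗ (tensorCons k V n).toLinearMap =
      (LinearMap.mul' k R ∘ₗ j.rTensor R) ∘ₗ (tensorPowerLift j n).lTensor V from
    LinearMap.congr_fun this x
  ext v w
  simp [tensorPowerLift, tensorCons_tprod, TensorAlgebra.tprod_apply, List.ofFn_succ]

theorem tensorPower_zero_eq_smul (t : ⨂[k]^0 V) :
    ∃ a : k, t = a • PiTensorProduct.tprod k Fin.elim0 := by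
  refine ⟨PiTensorProduct.isEmptyEquiv (Fin 0) t, ?_⟩
  apply (PiTensorProduct.isEmptyEquiv (R := k) (s := fun _ : Fin 0 => V) (Fin 0)).injective
  simp

variable [Coalgebra k R]

namespace IsTOBA

theorem proj_act (hR : IsTOBA D 𝒜) (hj : IsDegreeOne D 𝒜 DV j) (h : H) (x : R) :
    hj.proj hR.isInternal (D.act h x) = DV.act h (hj.proj hR.isInternal x) :=
  hj.injective (by
    rw [hj.apply_proj, hR.gradedProj_act, hj.isHom.map_act, hj.apply_proj])

/-- Only the degree-zero part of `x`, namely `ε(x) 1`, contributes to degree one of `j(v) x`. -/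
theorem proj_mul (hR : IsTOBA D 𝒜) (hj : IsDegreeOne D 𝒜 DV j) (v : V) (x : R) :
    hj.proj hR.isInternal (j v * x) = Coalgebra.counit (R := k) x • v := by
  suffices hj.proj hR.isInternal ∘ₗ LinearMap.mulLeft k (j v) =
      (Coalgebra.counit (R := k) (A := R)).smulRight v from LinearMap.congr_fun this x
  refine hR.isInternal.linearMap_ext fun n x hx => ?_
  rw [LinearMap.comp_apply, LinearMap.mulLeft_apply, LinearMap.smulRight_apply]
  cases n with
  | zero =>
    conv_lhs => rw [hR.eq_counit_smul_one hx]
    rw [mul_smul_comm, mul_one, map_smul, hj.proj_apply]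
  | succ n =>
    rw [hR.counit_of_mem_succ hx, zero_smul,
      hj.proj_of_mem_ne _ (by omega) (hR.mul_mem _ _ _ (hj.mem v) _ hx)]

/-! ### The skew derivation, its Leibniz rule and its injectivity -/

/-- The component `R → V ⊗ R` of the comultiplication. -/
def skewDer (hR : IsTOBA D 𝒜) (hj : IsDegreeOne D 𝒜 DV j) : R →ₗ[k] V ⊗[k] R :=
  (hj.proj hR.isInternal).rTensor R ∘ₗ Coalgebra.comul

theorem skewDer_apply (hR : IsTOBA D 𝒜) (hj : IsDegreeOne D 𝒜 DV j) (x : R) :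
    hR.skewDer hj x = (hj.proj hR.isInternal).rTensor R (Coalgebra.comul x) := rfl

theorem skewDer_one (hR : IsTOBA D 𝒜) (hj : IsDegreeOne D 𝒜 DV j) : hR.skewDer hj 1 = 0 := by
  rw [skewDer_apply, hR.comul_one, LinearMap.rTensor_tmul,
    hj.proj_of_mem_ne _ zero_ne_one hR.one_mem, TensorProduct.zero_tmul]

/-- `∂(v x) = v ⊗ x + (id ⊗ m)(c ⊗ id)(v ⊗ ∂(x))`. -/
theorem skewDer_mul (hR : IsTOBA D 𝒜) (hj : IsDegreeOne D 𝒜 DV j) (v : V) (x : R) :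
    hR.skewDer hj (j v * x) = v ⊗ₜ x + (LinearMap.mul' k R ∘ₗ j.rTensor R).lTensor V
      (braidHead (DV.braiding DV) R (v ⊗ₜ hR.skewDer hj x)) := by
  rw [skewDer_apply, hR.comul_mul, hR.comul_of_mem_one (hj.mem v), TensorProduct.add_tmul,
    map_add, map_add, add_comm, skewDer_apply]
  congr 1
  -- The summand `(j(v) ⊗ 1) Δ(x)`: projecting the first leg leaves `v ⊗ ε(x₍₁₎) x₍₂₎ = v ⊗ x`.
  · have h1 (t : R ⊗[k] R) : (hj.proj hR.isInternal).rTensor R (D.braidedMul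
        ((j v ⊗ₜ 1) ⊗ₜ t)) = (LinearMap.toSpanSingleton k V v).rTensor R
        ((Coalgebra.counit (R := k) (A := R)).rTensor R t) := by
      induction t with
      | zero => simp
      | add x y hx hy => simp only [map_add, TensorProduct.tmul_add, hx, hy]
      | tmul a b =>
        rw [YDData.braidedMul_tmul, hR.braiding_one_tmul]
        simp [hR.proj_mul]
    rw [h1, Coalgebra.rTensor_counit_comul]
    simp
  -- The summand `(1 ⊗ j(v)) Δ(x)`: the braiding moves `v` past the first leg, and the projection to
  -- `V` commutes with this because it is `H`-linear.
  · generalize Coalgebra.comul (R := k) x = t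
    induction t with
    | zero => simp
    | add x y hx hy => simp only [map_add, TensorProduct.tmul_add, hx, hy]
    | tmul a b =>
      rw [YDData.braidedMul_tmul, LinearMap.rTensor_tmul, braidHead_tmul, YDData.braiding_tmul,
        YDData.braiding_tmul, hj.isHom.map_coact]
      generalize DV.coact v = s
      induction s with
      | zero => simp
      | add x y hx hy => simp only [map_add, TensorProduct.add_tmul, hx, hy]
      | tmul h u => simp [hR.proj_act]

/-- `∂` lowers the degree by one, as only bidegrees `(1, n)` survive the projection of the first
leg. -/
theorem skewDer_gradedProj (hR : IsTOBA D 𝒜) (hj : IsDegreeOne D 𝒜 DV j) (n : ℕ) :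
    hR.skewDer hj ∘ₗ gradedProj hR.isInternal (n + 1) =
      (gradedProj hR.isInternal n).lTensor V ∘ₗ hR.skewDer hj := by
  refine hR.isInternal.linearMap_ext fun m x hx => ?_
  rw [LinearMap.comp_apply, LinearMap.comp_apply, skewDer_apply, skewDer_apply]
  rcases eq_or_ne m (n + 1) with rfl | hm
  · rw [gradedProj_of_mem _ hx, ← LinearMap.comp_apply (LinearMap.lTensor V _)]
    refine hR.comul_ext (fun i l hil a ha b hb => ?_) hx
    rw [LinearMap.comp_apply, LinearMap.rTensor_tmul, LinearMap.lTensor_tmul]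
    rcases eq_or_ne i 1 with rfl | hi
    · rw [gradedProj_of_mem _ (show b ∈ 𝒜 n by rwa [show n = l by omega])]
    · rw [hj.proj_of_mem_ne _ hi ha, TensorProduct.zero_tmul, TensorProduct.zero_tmul]
  · rw [gradedProj_of_mem_ne _ hx hm, map_zero, map_zero,
      ← LinearMap.comp_apply (LinearMap.lTensor V _)]
    refine (LinearMap.zero_apply (σ₁₂ := RingHom.id k) _).symm.trans
      (hR.comul_ext (fun i l hil a ha b hb => ?_) hx)
    rw [LinearMap.comp_apply, LinearMap.rTensor_tmul, LinearMap.lTensor_tmul, LinearMap.zero_apply]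
    rcases eq_or_ne i 1 with rfl | hi
    · rw [gradedProj_of_mem_ne _ hb (by omega), TensorProduct.tmul_zero]
    · rw [hj.proj_of_mem_ne _ hi ha, TensorProduct.zero_tmul]

theorem skewDer_coassoc (hR : IsTOBA D 𝒜) (hj : IsDegreeOne D 𝒜 DV j) (x : R) :
    (hR.skewDer hj).rTensor R (Coalgebra.comul x) = (TensorProduct.assoc k V R R).symm
      ((Coalgebra.comul (R := k) (A := R)).lTensor V (hR.skewDer hj x)) := by
  have h1 (t : R ⊗[k] (R ⊗[k] R)) :
      ((hj.proj hR.isInternal).rTensor R).rTensor R ((TensorProduct.assoc k R R R).symm t) =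
      (TensorProduct.assoc k V R R).symm ((hj.proj hR.isInternal).rTensor _ t) := by
    suffices ((hj.proj hR.isInternal).rTensor R).rTensor R ∘ₗ
        (TensorProduct.assoc k R R R).symm.toLinearMap =
        (TensorProduct.assoc k V R R).symm.toLinearMap ∘ₗ (hj.proj hR.isInternal).rTensor _ from
      LinearMap.congr_fun this t
    exact TensorProduct.ext_threefold' fun x y z => by simp
  rw [skewDer, LinearMap.rTensor_comp_apply, ← Coalgebra.coassoc_symm_apply, h1,
    LinearMap.comp_apply]
  congr 1
  generalize Coalgebra.comul (R := k) x = t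
  induction t with
  | zero => simp
  | add x y hx hy => simp only [map_add, hx, hy]
  | tmul a b => simp

/-- Coassociativity turns `∂x = 0` into `(∂ ⊗ id)Δ(x) = 0`. By induction `∂` is injective on the
lower degrees `i + 1 ≤ n`, so those components of `Δ(x)` vanish and `x` is primitive of degree at
least two. -/
theorem eq_zero_of_skewDer (hR : IsTOBA D 𝒜) (hj : IsDegreeOne D 𝒜 DV j) (n : ℕ) :
    ∀ x ∈ 𝒜 (n + 1), hR.skewDer hj x = 0 → x = 0 := by
  induction n using Nat.strong_induction_on with
  | _ n ih =>
    intro x hx h0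
    rcases eq_or_ne n 0 with rfl | hn
    -- In degree one `∂x = π(x) ⊗ 1`, and `id ⊗ ε` recovers `π(x)`.
    · have h1 := congrArg (TensorProduct.rid k V ∘ (Coalgebra.counit (R := k) (A := R)).lTensor V)
        h0
      rw [skewDer_apply, hR.comul_of_mem_one hx, map_add, LinearMap.rTensor_tmul,
        LinearMap.rTensor_tmul, hj.proj_of_mem_ne _ zero_ne_one hR.one_mem] at h1
      simp only [TensorProduct.zero_tmul, zero_add, Function.comp_apply, LinearMap.lTensor_tmul,
        hR.counit_one, TensorProduct.rid_tmul, one_smul, map_zero] at h1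
      rw [← gradedProj_of_mem hR.isInternal hx, ← hj.apply_proj, h1, map_zero]
    · refine hR.eq_zero_of_rTensor_comul_eq_zero hx (fun i hi => ?_) hn
      refine rTensor_eq_zero_of_injOn (ih i hi) (gradedProj_mem _ _) ?_
      rw [← LinearMap.rTensor_comp_apply, hR.skewDer_gradedProj, LinearMap.rTensor_comp_apply,
        hR.skewDer_coassoc, h0, map_zero, map_zero, map_zero]

/-- The component `R → V^{⊗n}` of the iterated comultiplication. -/
def iterSkewDer (hR : IsTOBA D 𝒜) (hj : IsDegreeOne D 𝒜 DV j) : (n : ℕ) → R →ₗ[k] ⨂[k]^n V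
  | 0 => (Coalgebra.counit (R := k) (A := R)).smulRight (PiTensorProduct.tprod k Fin.elim0)
  | n + 1 => (tensorCons k V n).toLinearMap ∘ₗ (hR.iterSkewDer hj n).lTensor V ∘ₗ hR.skewDer hj

theorem eq_zero_of_iterSkewDer (hR : IsTOBA D 𝒜) (hj : IsDegreeOne D 𝒜 DV j) (n : ℕ) :
    ∀ x ∈ 𝒜 n, hR.iterSkewDer hj n x = 0 → x = 0 := by
  induction n with
  | zero =>
    intro x hx h
    have h1 := congrArg (PiTensorProduct.isEmptyEquiv (R := k) (s := fun _ : Fin 0 => V) (Fin 0)) h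
    rw [hR.eq_counit_smul_one hx]
    simp [iterSkewDer] at h1
    rw [h1, zero_smul]
  | succ n ih =>
    intro x hx h
    refine hR.eq_zero_of_skewDer hj n x hx ?_
    have h1 := LinearMap.congr_fun (hR.skewDer_gradedProj hj n) x
    rw [LinearMap.comp_apply, gradedProj_of_mem _ hx, LinearMap.comp_apply] at h1
    rw [h1]
    refine lTensor_eq_zero_of_injOn ih (gradedProj_mem _ _) ?_
    rw [← h1]
    simpa [iterSkewDer] using h

theorem tensorPowerLift_mem (hR : IsTOBA D 𝒜) (hj : IsDegreeOne D 𝒜 DV j) (n : ℕ)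
    (t : ⨂[k]^n V) : tensorPowerLift j n t ∈ 𝒜 n := by
  induction n with
  | zero =>
    obtain ⟨a, rfl⟩ := tensorPower_zero_eq_smul t
    rw [map_smul, tensorPowerLift_zero]
    exact Submodule.smul_mem _ _ hR.one_mem
  | succ n ih =>
    obtain ⟨x, rfl⟩ := (tensorCons k V n).surjective t
    rw [tensorPowerLift_tensorCons]
    induction x with
    | zero => simp
    | add x y hx hy => simp only [map_add]; exact add_mem hx hy
    | tmul v t =>
      have := hR.mul_mem 1 n _ (hj.mem v) _ (ih t)
      rw [add_comm] at this
      simpa using this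

/-- Induction with the Leibniz rule: in `∂(vx)` the term `v ⊗ x` is the summand `1` of
`cosetSum_succ`, and the braided term is `σ₀` applied after the shifted sum. -/
theorem skewDer_tensorPowerLift (hR : IsTOBA D 𝒜) (hj : IsDegreeOne D 𝒜 DV j) (n : ℕ)
    (t : ⨂[k]^(n + 1) V) :
    hR.skewDer hj (tensorPowerLift j (n + 1) t) =
      (tensorPowerLift j n).lTensor V ((tensorCons k V n).symm (cosetSum DV n t)) := by
  induction n with
  | zero =>
    obtain ⟨x, rfl⟩ := (tensorCons k V 0).surjective t
    rw [tensorPowerLift_tensorCons, cosetSum_zero, Module.End.one_apply,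
      LinearEquiv.symm_apply_apply]
    induction x with
    | zero => simp
    | add x y hx hy => simp only [map_add, hx, hy]
    | tmul v t =>
      obtain ⟨a, rfl⟩ := tensorPower_zero_eq_smul t
      have := hR.skewDer_mul hj v (tensorPowerLift j 0 (a • PiTensorProduct.tprod k Fin.elim0))
      rw [map_smul, tensorPowerLift_zero, map_smul, skewDer_one, smul_zero,
        TensorProduct.tmul_zero, map_zero, map_zero, add_zero] at this
      simpa [tensorPowerLift_zero] using this
  | succ n ih =>
    obtain ⟨x, rfl⟩ := (tensorCons k V (n + 1)).surjective t
    induction x with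
    | zero => simp
    | add x y hx hy => simp only [map_add, hx, hy]
    | tmul v s =>
      obtain ⟨y, hy⟩ : ∃ y, cosetSum DV n s = tensorCons k V n y :=
        ⟨_, ((tensorCons k V n).apply_symm_apply _).symm⟩
      have h1 := ih s
      rw [hy, LinearEquiv.symm_apply_apply] at h1
      have h2 : shiftEnd (n + 1) (cosetSum DV n) (tensorCons k V (n + 1) (v ⊗ₜ s)) =
          tensorCons k V (n + 1) ((tensorCons k V n).toLinearMap.lTensor V (v ⊗ₜ y)) := by
        rw [shiftEnd_tensorCons, LinearMap.lTensor_tmul, LinearMap.lTensor_tmul, hy]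
        rfl
      rw [tensorPowerLift_tensorCons, LinearMap.lTensor_tmul, LinearMap.comp_apply,
        LinearMap.rTensor_tmul, LinearMap.mul'_apply, skewDer_mul, h1, cosetSum_succ,
        LinearMap.add_apply, Module.End.mul_apply, Module.End.one_apply, h2, sigma_zero, map_add,
        LinearEquiv.symm_apply_apply, LinearEquiv.symm_apply_apply, map_add,
        LinearMap.lTensor_tmul, ← LinearMap.lTensor_comp_apply]
      congr 1
      rw [show tensorPowerLift j (n + 1) ∘ₗ (tensorCons k V n).toLinearMap =
          (LinearMap.mul' k R ∘ₗ j.rTensor R) ∘ₗ (tensorPowerLift j n).lTensor V from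
        LinearMap.ext fun x => tensorPowerLift_tensorCons j n x, LinearMap.lTensor_comp_apply,
        ← LinearMap.lTensor_tmul, ← LinearMap.comp_apply (braidHead _ _),
        braidHead_comp_lTensor_lTensor, LinearMap.comp_apply]
      simp only [LinearMap.lTensor_comp_apply]

/-- The quantum symmetrizer is the composition of the multiplication `V^{⊗n} → R` and of the
component `R → V^{⊗n}` of the iterated comultiplication. -/
theorem iterSkewDer_tensorPowerLift (hR : IsTOBA D 𝒜) (hj : IsDegreeOne D 𝒜 DV j) (n : ℕ)
    (t : ⨂[k]^n V) :
    hR.iterSkewDer hj n (tensorPowerLift j n t) = DV.symmetrizer n t := by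
  induction n with
  | zero =>
    obtain ⟨a, rfl⟩ := tensorPower_zero_eq_smul t
    rw [symmetrizer_zero, map_smul, tensorPowerLift_zero]
    simp [iterSkewDer, hR.counit_one]
  | succ n ih =>
    rw [symmetrizer_succ (hj.isYangBaxter hR.yetterDrinfeld), Module.End.mul_apply, iterSkewDer,
      LinearMap.comp_apply, LinearMap.comp_apply, skewDer_tensorPowerLift,
      ← LinearMap.lTensor_comp_apply,
      show hR.iterSkewDer hj n ∘ₗ tensorPowerLift j n = DV.symmetrizer n from LinearMap.ext ih]
    obtain ⟨x, hx⟩ := (tensorCons k V n).surjective (cosetSum DV n t)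
    rw [← hx, LinearEquiv.symm_apply_apply, shiftEnd_tensorCons]
    rfl

theorem tensorPowerLift_eq_zero_iff (hR : IsTOBA D 𝒜) (hj : IsDegreeOne D 𝒜 DV j) (n : ℕ)
    (t : ⨂[k]^n V) : tensorPowerLift j n t = 0 ↔ DV.symmetrizer n t = 0 := by
  rw [← hR.iterSkewDer_tensorPowerLift hj]
  refine ⟨fun h => by rw [h, map_zero], fun h => ?_⟩
  exact hR.eq_zero_of_iterSkewDer hj n _ (hR.tensorPowerLift_mem hj n t) h

/-- `p` is graded, so its kernel can be computed one tensor power at a time, like that of `𝔖`. -/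
theorem gradedProj_lift (hR : IsTOBA D 𝒜) (hj : IsDegreeOne D 𝒜 DV j) (n : ℕ)
    (x : TensorAlgebra k V) :
    gradedProj hR.isInternal n (TensorAlgebra.lift k j x) =
      tensorPowerLift j n (TensorAlgebra.equivDirectSum x n) := by
  obtain ⟨d, rfl⟩ := (TensorAlgebra.equivDirectSum (R := k) (M := V)).symm.surjective x
  rw [AlgEquiv.apply_symm_apply]
  suffices gradedProj hR.isInternal n ∘ₗ (TensorAlgebra.lift k j).toLinearMap ∘ₗ
      (TensorAlgebra.equivDirectSum (R := k) (M := V)).symm.toLinearMap =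
      tensorPowerLift j n ∘ₗ DirectSum.component k ℕ (fun n => ⨂[k]^n V) n from
    LinearMap.congr_fun this d
  refine DirectSum.linearMap_ext k fun m => LinearMap.ext fun t => ?_
  have h1 : (TensorAlgebra.equivDirectSum (R := k) (M := V)).symm
      (DirectSum.lof k ℕ (fun n => ⨂[k]^n V) m t) = TensorPower.toTensorAlgebra t :=
    DirectSum.toAddMonoid_of
      (fun _ ↦ LinearMap.toAddMonoidHom (TensorPower.toTensorAlgebra (R := k) (M := V))) m t
  have h2 := hR.tensorPowerLift_mem hj m t
  simp only [LinearMap.comp_apply, AlgEquiv.toLinearMap_apply, AlgHom.toLinearMap_apply]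
  rw [h1]
  rcases eq_or_ne m n with rfl | hm
  · rw [DirectSum.component.lof_self]
    exact gradedProj_of_mem _ h2
  · rw [DirectSum.component.of, dif_neg hm, map_zero]
    exact gradedProj_of_mem_ne _ h2 hm

theorem ker_lift (hR : IsTOBA D 𝒜) (hj : IsDegreeOne D 𝒜 DV j) :
    LinearMap.ker (TensorAlgebra.lift k j).toLinearMap =
      LinearMap.ker DV.quantumSymmetrizer := by
  ext x
  rw [LinearMap.mem_ker, LinearMap.mem_ker, AlgHom.toLinearMap_apply]
  have h1 : TensorAlgebra.lift k j x = 0 ↔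
      ∀ n, tensorPowerLift j n (TensorAlgebra.equivDirectSum x n) = 0 := by
    simp only [← hR.gradedProj_lift hj]
    exact ⟨fun h n => by rw [h, map_zero], eq_zero_of_gradedProj _⟩
  have h2 : DV.quantumSymmetrizer x = 0 ↔
      ∀ n, DV.symmetrizer n (TensorAlgebra.equivDirectSum x n) = 0 := by
    rw [DFinsupp.ext_iff]
    rfl
  simp only [h1, h2, hR.tensorPowerLift_eq_zero_iff hj]

theorem map_lift_pow (hR : IsTOBA D 𝒜) (hj : IsDegreeOne D 𝒜 DV j) (n : ℕ) :
    Submodule.map (TensorAlgebra.lift k j).toLinearMap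
      (LinearMap.range (TensorAlgebra.ι k : V →ₗ[k] TensorAlgebra k V) ^ n) = 𝒜 n := by
  rw [Submodule.map_pow, ← LinearMap.range_comp, hR.eq_pow n, ← hj.range_eq]
  congr 2
  ext v
  simp

theorem surjective_lift (hR : IsTOBA D 𝒜) (hj : IsDegreeOne D 𝒜 DV j) :
    Function.Surjective (TensorAlgebra.lift k j) := by
  have : (⊤ : Submodule k R) ≤ LinearMap.range (TensorAlgebra.lift k j).toLinearMap := by
    rw [← hR.isInternal.submodule_iSup_eq_top]
    refine iSup_le fun n => ?_
    rw [← hR.map_lift_pow hj n]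
    exact LinearMap.map_le_range
  exact fun x => this trivial

end IsTOBA

end Kernel

/-! ### Compatibility of `A(V) → R` with the structure maps -/

section Structure

variable {k H R V : Type*} [Field k] [Ring H] [HopfAlgebra k H] [Ring R] [Algebra k R]
  [AddCommGroup V] [Module k V] {D : YDData k H R} {𝒜 : ℕ → Submodule k R}
  {DV : YDData k H V} {j : V →ₗ[k] R}

theorem YDData.tensorAlgebra_act (DV : YDData k H V) (h : H) (x : TensorAlgebra k V) :
    DV.tensorAlgebra.act h x = (DV.tensorAlgebraOrbit x).ofConv h := rfl

theorem YDData.tensorAlgebra_coact (DV : YDData k H V) (x : TensorAlgebra k V) :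
    DV.tensorAlgebra.coact x =
      TensorAlgebra.lift k ((TensorAlgebra.ι k).lTensor H ∘ₗ DV.coact) x := rfl

theorem YDData.IsHom.comp {M N P : Type*} [AddCommGroup M] [Module k M] [AddCommGroup N]
    [Module k N] [AddCommGroup P] [Module k P] {DM : YDData k H M} {DN : YDData k H N}
    {DP : YDData k H P} {g : N →ₗ[k] P} {f : M →ₗ[k] N} (hg : DN.IsHom DP g)
    (hf : DM.IsHom DN f) : DM.IsHom DP (g ∘ₗ f) where
  map_act h m := by rw [LinearMap.comp_apply, hf.map_act, hg.map_act, LinearMap.comp_apply]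
  map_coact m := by
    rw [LinearMap.comp_apply, hg.map_coact, hf.map_coact, LinearMap.lTensor_comp_apply]

theorem YDData.isHom_subtype {M : Type*} [AddCommGroup M] [Module k M] (DM : YDData k H M)
    (W : Submodule k M) (hW : DM.IsSub W) : (DM.restrict W hW).IsHom DM W.subtype where
  map_act _ _ := rfl
  map_coact w := by
    have := LinearEquiv.apply_symm_apply (LinearEquiv.ofInjective (W.subtype.lTensor H)
      (Module.Flat.lTensor_preserves_injective_linearMap _ W.injective_subtype))
      (LinearMap.codRestrict _ (DM.coact ∘ₗ W.subtype) (fun w => hW.coact_mem w w.2) w)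
    exact (congrArg Subtype.val this).symm

/-- Multiplicative morphisms of Yetter–Drinfeld modules are morphisms for the braided tensor
products. -/
theorem YDData.IsHom.map_braidedMul {T : Type*} [Ring T] [Algebra k T] {DT : YDData k H T}
    {p : T →ₐ[k] R} (hp : DT.IsHom D p.toLinearMap) (s t : T ⊗[k] T) :
    TensorProduct.map p.toLinearMap p.toLinearMap (DT.braidedMul (s ⊗ₜ t)) =
      D.braidedMul (TensorProduct.map p.toLinearMap p.toLinearMap s ⊗ₜ
        TensorProduct.map p.toLinearMap p.toLinearMap t) := by
  induction s with
  | zero => simp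
  | add x y hx hy => simp only [TensorProduct.add_tmul, map_add, hx, hy]
  | tmul a b =>
    induction t with
    | zero => simp
    | add x y hx hy => simp only [TensorProduct.tmul_add, map_add, hx, hy]
    | tmul a' b' =>
      rw [TensorProduct.map_tmul, TensorProduct.map_tmul, braidedMul_tmul, braidedMul_tmul,
        ← TensorProduct.map_tmul p.toLinearMap p.toLinearMap b a', ← hp.map_braiding]
      generalize DT.braiding DT (b ⊗ₜ a') = z
      induction z with
      | zero => simp
      | add x y hx hy => simp only [map_add, hx, hy]
      | tmul x y => simp

variable [Coalgebra k R]

namespace IsBraidedHopfAlgebra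

theorem act_mul (hR : IsBraidedHopfAlgebra D) (h : H) (x y : R) :
    D.act h (x * y) = LinearMap.mul' k R
      (TensorProduct.map (D.act.flip x) (D.act.flip y) (Coalgebra.comul (R := k) h)) := by
  rw [← YDData.tensor_act_tmul, hR.mul_hom.map_act, LinearMap.mul'_apply]

theorem act_algebraMap (hR : IsBraidedHopfAlgebra D) (h : H) (r : k) :
    D.act h (algebraMap k R r) = algebraMap k R (Coalgebra.counit (R := k) h * r) :=
  (hR.unit_hom.map_act h r).symm

/-- Colinearity of the multiplication says that the coaction is multiplicative into the ordinary,
unbraided, algebra `H ⊗ R`. -/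
theorem coact_mul (hR : IsBraidedHopfAlgebra D) (x y : R) :
    D.coact (x * y) = D.coact x * D.coact y := by
  have h := hR.mul_hom.map_coact (x ⊗ₜ y)
  rw [LinearMap.mul'_apply, YDData.tensor_coact_tmul] at h
  rw [h]
  generalize D.coact x = s
  generalize D.coact y = t
  induction s with
  | zero => simp
  | add x y hx hy => simp only [TensorProduct.add_tmul, map_add, hx, hy, add_mul]
  | tmul a b =>
    induction t with
    | zero => simp
    | add x y hx hy => simp only [TensorProduct.tmul_add, map_add, hx, hy, mul_add]
    | tmul a' b' => simp

theorem coact_algebraMap (hR : IsBraidedHopfAlgebra D) (r : k) :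
    D.coact (algebraMap k R r) = algebraMap k (H ⊗[k] R) r := by
  have h := hR.unit_hom.map_coact r
  rw [Algebra.linearMap_apply] at h
  rw [h, Algebra.TensorProduct.algebraMap_apply, Algebra.algebraMap_eq_smul_one,
    TensorProduct.smul_tmul, ← Algebra.algebraMap_eq_smul_one]
  simp [YDData.unit]

/-- The algebra map `A(V) → R` extending a morphism `V → R` of Yetter–Drinfeld modules is a
morphism of Yetter–Drinfeld modules. -/
theorem isHom_lift (hR : IsBraidedHopfAlgebra D) (hj : DV.IsHom D j) :
    DV.tensorAlgebra.IsHom D (TensorAlgebra.lift k j).toLinearMap where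
  map_act h x := by
    simp only [AlgHom.toLinearMap_apply, YDData.tensorAlgebra_act]
    -- On a product, `h` acts through `h₍₁₎` and `h₍₂₎`, so the hypothesis is needed for all
    -- elements of `H`.
    induction x using TensorAlgebra.induction generalizing h with
    | algebraMap r =>
      rw [AlgHom.commutes, AlgHom.commutes, hR.act_algebraMap,
        Algebra.algebraMap_eq_smul_one r, WithConv.ofConv_smul, LinearMap.smul_apply, map_smul,
        LinearMap.convOne_apply, AlgHom.commutes, mul_comm, map_mul, Algebra.smul_def]
    | ι v =>
      rw [YDData.tensorAlgebraOrbit, TensorAlgebra.lift_ι_apply, TensorAlgebra.lift_ι_apply,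
        ← hj.map_act]
      exact TensorAlgebra.lift_ι_apply _ _
    | mul x y hx hy =>
      rw [map_mul, map_mul, hR.act_mul, LinearMap.convMul_apply]
      generalize Coalgebra.comul (R := k) h = s
      induction s with
      | zero => simp
      | add x y hx hy => simp only [map_add, hx, hy]
      | tmul a b => simp [hx, hy]
    | add x y hx hy =>
      rw [map_add, map_add, map_add, WithConv.ofConv_add, LinearMap.add_apply, map_add, hx, hy]
  map_coact x := by
    rw [AlgHom.toLinearMap_apply, YDData.tensorAlgebra_coact]
    have h1 (t : H ⊗[k] TensorAlgebra k V) :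
        (TensorAlgebra.lift k j).toLinearMap.lTensor H t =
        Algebra.TensorProduct.map (AlgHom.id k H) (TensorAlgebra.lift k j) t := rfl
    rw [h1]
    induction x using TensorAlgebra.induction with
    | algebraMap r =>
      rw [AlgHom.commutes, AlgHom.commutes, AlgHom.commutes, hR.coact_algebraMap]
    | ι v =>
      rw [TensorAlgebra.lift_ι_apply, TensorAlgebra.lift_ι_apply, hj.map_coact, ← h1,
        LinearMap.comp_apply, ← LinearMap.lTensor_comp_apply]
      congr 2
      ext v
      simp
    | mul x y hx hy => rw [map_mul (TensorAlgebra.lift k j), hR.coact_mul, hx, hy, map_mul, map_mul]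
    | add x y hx hy => rw [map_add, map_add, map_add, map_add, hx, hy]

end IsBraidedHopfAlgebra

namespace IsTOBA

theorem counit_lift (hR : IsTOBA D 𝒜) (hj : IsDegreeOne D 𝒜 DV j) (x : TensorAlgebra k V) :
    Coalgebra.counit (R := k) (TensorAlgebra.lift k j x) = TensorAlgebra.algebraMapInv x := by
  induction x using TensorAlgebra.induction with
  | algebraMap r =>
    rw [AlgHom.commutes, AlgHom.commutes, Algebra.algebraMap_eq_smul_one, map_smul, hR.counit_one]
    simp
  | ι v =>
    rw [TensorAlgebra.lift_ι_apply, hR.counit_of_mem_one (hj.mem v)]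
    simp [TensorAlgebra.algebraMapInv]
  | mul x y hx hy => rw [map_mul (TensorAlgebra.lift k j), hR.counit_mul, hx, hy, map_mul]
  | add x y hx hy => rw [map_add, map_add, map_add, hx, hy]

/-- The comultiplication of `A(V)` is built from left multiplication operators applied to `1 ⊗ 1`.
Accordingly, the induction shows that left multiplication by `x` preserves the subspace where the
two sides agree; this avoids associativity of the braided product on `A(V) ⊗ A(V)`. -/
theorem comul_lift (hR : IsTOBA D 𝒜) (hj : IsDegreeOne D 𝒜 DV j) (x : TensorAlgebra k V) :
    Coalgebra.comul (R := k) (TensorAlgebra.lift k j x) =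
      TensorProduct.map (TensorAlgebra.lift k j).toLinearMap (TensorAlgebra.lift k j).toLinearMap
        (DV.tensorAlgebraComul x) := by
  let L : TensorAlgebra k V →ₗ[k] R ⊗[k] R :=
    Coalgebra.comul ∘ₗ (TensorAlgebra.lift k j).toLinearMap
  let L' : TensorAlgebra k V →ₗ[k] R ⊗[k] R :=
    TensorProduct.map (TensorAlgebra.lift k j).toLinearMap (TensorAlgebra.lift k j).toLinearMap
      ∘ₗ DV.tensorAlgebraComul
  suffices h : ∀ y ∈ LinearMap.eqLocus L L', x * y ∈ LinearMap.eqLocus L L' by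
    have h1 := h 1 (by
      rw [LinearMap.mem_eqLocus]
      simp [L, L', YDData.tensorAlgebraComul, hR.comul_one])
    rwa [mul_one] at h1
  induction x using TensorAlgebra.induction with
  | algebraMap r =>
    intro y hy
    rw [← Algebra.smul_def]
    exact Submodule.smul_mem _ r hy
  | ι v =>
    intro y hy
    have hy' : Coalgebra.comul (R := k) (TensorAlgebra.lift k j y) =
      TensorProduct.map (TensorAlgebra.lift k j).toLinearMap (TensorAlgebra.lift k j).toLinearMap
        (DV.tensorAlgebraComul y) := hy
    have h1 : DV.tensorAlgebraComul (TensorAlgebra.ι k v * y) = DV.tensorAlgebra.braidedMul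
        ((TensorAlgebra.ι k v ⊗ₜ 1 + 1 ⊗ₜ TensorAlgebra.ι k v) ⊗ₜ DV.tensorAlgebraComul y) := by
      simp [YDData.tensorAlgebraComul, YDData.tensorAlgebraComulAux, TensorProduct.add_tmul]
    change Coalgebra.comul (R := k) (TensorAlgebra.lift k j (TensorAlgebra.ι k v * y)) =
      TensorProduct.map (TensorAlgebra.lift k j).toLinearMap (TensorAlgebra.lift k j).toLinearMap
        (DV.tensorAlgebraComul (TensorAlgebra.ι k v * y))
    rw [h1, (hR.isHom_lift hj.isHom).map_braidedMul, ← hy', map_mul, hR.comul_mul,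
      TensorAlgebra.lift_ι_apply, hR.comul_of_mem_one (hj.mem v)]
    simp [add_comm]
  | mul x y hx hy =>
    intro z hz
    rw [mul_assoc]
    exact hx _ (hy _ hz)
  | add x y hx hy =>
    intro z hz
    rw [add_mul]
    exact add_mem (hx z hz) (hy z hz)

/-- The isomorphism `𝔅(V) ≃ R` induced by `A(V) → R`. -/
def nicholsEquiv (hR : IsTOBA D 𝒜) (hj : IsDegreeOne D 𝒜 DV j) : DV.NicholsAlgebra ≃ₗ[k] R :=
  (Submodule.quotEquivOfEq _ _ (hR.ker_lift hj).symm).trans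
    ((TensorAlgebra.lift k j).toLinearMap.quotKerEquivOfSurjective (hR.surjective_lift hj))

theorem nicholsEquiv_apply (hR : IsTOBA D 𝒜) (hj : IsDegreeOne D 𝒜 DV j)
    (x : TensorAlgebra k V) :
    hR.nicholsEquiv hj (DV.toNichols x) = TensorAlgebra.lift k j x := rfl

theorem isNicholsIso (hR : IsTOBA D 𝒜) (hj : IsDegreeOne D 𝒜 DV j) :
    DV.IsNicholsIso D 𝒜 (hR.nicholsEquiv hj) where
  map_one := by rw [nicholsEquiv_apply, map_one]
  map_mul x y := by simp only [nicholsEquiv_apply, map_mul]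
  map_counit := hR.counit_lift hj
  map_comul := hR.comul_lift hj
  map_yetterDrinfeld := hR.isHom_lift hj.isHom
  map_grading := hR.map_lift_pow hj

theorem isDegreeOne (hR : IsTOBA D 𝒜) : IsDegreeOne D 𝒜 hR.degreeOne (𝒜 1).subtype where
  injective := Submodule.injective_subtype _
  range_eq := Submodule.range_subtype _
  isHom := D.isHom_subtype _ (hR.isSub 1)

/-- Two TOBAs with the same space of primitive elements are isomorphic. -/
theorem exists_iso {R' : Type*} [Ring R'] [Algebra k R'] [Coalgebra k R'] {D' : YDData k H R'}
    {𝒜' : ℕ → Submodule k R'} {j' : V →ₗ[k] R'} (hR : IsTOBA D 𝒜) (hj : IsDegreeOne D 𝒜 DV j)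
    (hR' : IsTOBA D' 𝒜') (hj' : IsDegreeOne D' 𝒜' DV j') :
    ∃ F : R ≃ₐ[k] R', IsGradedBraidedHopfIso D 𝒜 D' 𝒜' F ∧ ∀ v, F (j v) = j' v := by
  -- Both algebras are the quotient of the same `A(V)` by the same kernel. Each compatibility of `F`
  -- is then checked on images of elements of `A(V)`.
  let F₀ : R ≃ₗ[k] R' := (hR.nicholsEquiv hj).symm.trans (hR'.nicholsEquiv hj')
  have hF₀ (x : TensorAlgebra k V) :
      F₀ (TensorAlgebra.lift k j x) = TensorAlgebra.lift k j' x := by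
    rw [← hR.nicholsEquiv_apply hj, ← hR'.nicholsEquiv_apply hj', LinearEquiv.trans_apply,
      LinearEquiv.symm_apply_apply]
  have hsurj := hR.surjective_lift hj
  let F : R ≃ₐ[k] R' := AlgEquiv.ofLinearEquiv F₀
    (by rw [← map_one (TensorAlgebra.lift k j), hF₀, map_one])
    (by
      intro x y
      obtain ⟨x, rfl⟩ := hsurj x
      obtain ⟨y, rfl⟩ := hsurj y
      rw [← map_mul, hF₀, hF₀, hF₀, map_mul])
  have hF (x : TensorAlgebra k V) :
      F (TensorAlgebra.lift k j x) = TensorAlgebra.lift k j' x := hF₀ x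
  have hcomp : F.toLinearMap ∘ₗ (TensorAlgebra.lift k j).toLinearMap =
      (TensorAlgebra.lift k j').toLinearMap := LinearMap.ext hF
  refine ⟨F, ⟨fun x => ?_, fun x => ?_, ⟨fun h x => ?_, fun x => ?_⟩, fun n => ?_⟩, fun v => ?_⟩
  · obtain ⟨x, rfl⟩ := hsurj x
    rw [hF, hR.counit_lift hj, hR'.counit_lift hj']
  · obtain ⟨x, rfl⟩ := hsurj x
    rw [hF, hR.comul_lift hj, hR'.comul_lift hj', TensorProduct.map_map, hcomp]
  · obtain ⟨x, rfl⟩ := hsurj x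
    have h1 := (hR.isHom_lift hj.isHom).map_act h x
    have h2 := (hR'.isHom_lift hj'.isHom).map_act h x
    simp only [AlgHom.toLinearMap_apply] at h1 h2
    rw [AlgEquiv.toLinearMap_apply, AlgEquiv.toLinearMap_apply, ← h1, hF, hF, h2]
  · obtain ⟨x, rfl⟩ := hsurj x
    have h1 := (hR.isHom_lift hj.isHom).map_coact x
    have h2 := (hR'.isHom_lift hj'.isHom).map_coact x
    simp only [AlgHom.toLinearMap_apply] at h1 h2
    rw [AlgEquiv.toLinearMap_apply, hF, h1, h2, ← LinearMap.lTensor_comp_apply, hcomp]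
  · rw [← hR.map_lift_pow hj n, ← hR'.map_lift_pow hj' n, ← Submodule.map_comp, hcomp]
  · rw [← TensorAlgebra.lift_ι_apply (R := k) j v, hF, TensorAlgebra.lift_ι_apply]

end IsTOBA

end Structure

end

theorem mainTheorem1 {k H R : Type*}
    [Field k] [Ring H] [HopfAlgebra k H]
    (hS : Function.Bijective (HopfAlgebra.antipode k : H → H))
    [Ring R] [Algebra k R] [Coalgebra k R]
    (D : YDData k H R) (𝒜 : ℕ → Submodule k R) (hR : IsTOBA D 𝒜) :
    -- the canonical algebra map `A(V) → R`, `V = R(1)`, is onto, with kernel `ker 𝔖`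
    Function.Surjective (TensorAlgebra.lift k (𝒜 1).subtype) ∧
    LinearMap.ker (TensorAlgebra.lift k (𝒜 1).subtype).toLinearMap =
      LinearMap.ker hR.degreeOne.quantumSymmetrizer ∧
    -- it induces an isomorphism `𝔅(V) ≃ R` of graded braided Hopf algebras
    (∃ φ : hR.degreeOne.NicholsAlgebra ≃ₗ[k] R,
      (∀ x, φ (hR.degreeOne.toNichols x) = TensorAlgebra.lift k (𝒜 1).subtype x) ∧
      hR.degreeOne.IsNicholsIso D 𝒜 φ) ∧
    -- TOBAs with isomorphic spaces of primitive elements are isomorphic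
    (∀ {R' : Type*} [Ring R'] [Algebra k R'] [Coalgebra k R']
      (D' : YDData k H R') (𝒜' : ℕ → Submodule k R') (hR' : IsTOBA D' 𝒜')
      (f : 𝒜 1 ≃ₗ[k] 𝒜' 1), hR.degreeOne.IsHom hR'.degreeOne f.toLinearMap →
      ∃ F : R ≃ₐ[k] R', IsGradedBraidedHopfIso D 𝒜 D' 𝒜' F ∧ ∀ v : 𝒜 1, F v = f v) := by
  refine ⟨hR.surjective_lift hR.isDegreeOne, hR.ker_lift hR.isDegreeOne,
    ⟨hR.nicholsEquiv hR.isDegreeOne, hR.nicholsEquiv_apply hR.isDegreeOne,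
      hR.isNicholsIso hR.isDegreeOne⟩, ?_⟩
  intro R' _ _ _ D' 𝒜' hR' f hf
  -- Through `f`, the same module `V = R(1)` also serves as the degree-one part of `R'`.
  have hj' : IsDegreeOne D' 𝒜' hR.degreeOne ((𝒜' 1).subtype ∘ₗ f.toLinearMap) :=
    { injective := (Submodule.injective_subtype _).comp f.injective
      range_eq := by rw [LinearMap.range_comp, LinearEquiv.range, Submodule.map_top,
        Submodule.range_subtype]
      isHom := hR'.isDegreeOne.isHom.comp hf }
  exact hR.exists_iso hR.isDegreeOne hR' hj'
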